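/- Let $a>0$, let $d\ge 2$ be an integer and let $v<-\log a$. For real points $x_1,\dots,x_d$ (repetitions allowed) put $\tau_d=\frac1d\sum_{k=1}^d\delta_{x_k}$, $U^{\tau_d}(z)=-\int\log|z-t|\,d\tau_d(t)$ and $$I[\tau_d]=-\frac{1}{d(d-1)}\sum_{j\ne k}\log|x_j-x_k|\in(-\infty,+\infty],$$ with $-\log 0=+\infty$. Configurations are regarded as unordered collections with multiplicities. (1) Every configuration with $U^{\tau_d}(ai)=v$ satisfies $$I[\tau_d]\ \ge\ 2v+\log(2a)-\frac{\log d}{d-1}.\qquad(\ast)$$ (2) Suppose $v\le\left(\frac1d-1\right)\log 2-\log a$. Put $$D=\frac{e^{-vd(2d-2)}\,d^d}{(2a)^{d(d-1)}},\qquad p=a^{d/2}\,2^{d/2-1}\,d^{d/(2d-2)}\,D^{-1/(2d-2)},$$ and let $\gamma=\frac{\arccos p}{d}$ if $d$ is odd, $\gamma=\frac{\arcsin p}{d}$ if $d$ is even. Then a configuration satisfies $U^{\tau_d}(ai)=v$ with equality in $(\ast)$ if and only if $\{x_1,\dots,x_d\}$ is $\{a\tan(\gamma+k\pi/d):k=0,\dots,d-1\}$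 or its reflection $\{-a\tan(\gamma+k\pi/d):k=0,\dots,d-1\}$ with respect to the origin. (3) Suppose $\left(\frac1d-1\right)\log 2-\log a<v<-\log a$. Then there is a unique real $\lambda_e>2d-2$ with $$1+\sum_{k=1}^{\lfloor d/2\rfloor}\binom{d}{2k}\frac{(2k-1)!!}{\prod_{j=1}^{k}(\lambda_e-2d+2j+1)}=\frac{e^{-vd}}{a^d}.$$ For this $\lambda_e$, the polynomial $$G(x)=G_{a,\lambda_e}(x)=x^d+\sum_{k=1}^{\lfloor d/2\rfloor}(-1)^k a^{2k}\binom{d}{2k}\frac{(2k-1)!!}{\prod_{j=1}^{k}(\lambda_e-2d+2j+1)}\,x^{d-2k}$$ has only real roots and its discriminant $\Delta_G$ is positive. Every configuration with $U^{\tau_d}(ai)=v$ satisfies $$I[\tau_d]\ \ge\ -\frac{\log\Delta_G}{d(d-1)},$$ and a configuration satisfies $U^{\tau_d}(ai)=v$ with equality here if and only if $x_1,\dots,x_d$ are the roots of $G_{a,\lambda_e}$. -/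

import Mathlib

open Polynomial

noncomputable section

/-- The normalized counting measure `τ_d = (1/d) ∑ δ_{x_k}` of a configuration of `d` real points
(repetitions allowed). -/
def countingMeasure {d : ℕ} (x : Fin d → ℝ) : MeasureTheory.Measure ℝ :=
  (d : ENNReal)⁻¹ • ∑ k, MeasureTheory.Measure.dirac (x k)

/-- The logarithmic potential `U^τ(z) = - ∫ log |z - t| dτ(t)` of a measure on the real line. -/
def logPotential (τ : MeasureTheory.Measure ℝ) (z : ℂ) : ℝ :=
  - ∫ t : ℝ, Real.log ‖z - (t : ℂ)‖ ∂τ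

/-- `- log r` for `r ≥ 0`, with the value `+∞` at `r = 0`. -/
def negLog (r : ℝ) : EReal := if r = 0 then ⊤ else ((- Real.log r : ℝ) : EReal)

/-- The discrete energy `I[τ_d] = - (1/(d(d-1))) ∑_{j ≠ k} log |x_j - x_k|`; it is `+∞` as soon
as two of the points coincide. -/
def discreteEnergy {d : ℕ} (x : Fin d → ℝ) : EReal :=
  ((1 / ((d : ℝ) * ((d : ℝ) - 1)) : ℝ) : EReal) *
    ∑ j, ∑ k ∈ Finset.univ.erase j, negLog |x j - x k|

/-- The configuration as an unordered collection of points with multiplicities. -/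
def pointMultiset {d : ℕ} (x : Fin d → ℝ) : Multiset ℝ := Finset.univ.val.map x

/-- `p(a,d,D) = a^{d/2} 2^{d/2-1} d^{d/(2d-2)} D^{-1/(2d-2)}`. -/
def tanParam (a : ℝ) (d : ℕ) (D : ℝ) : ℝ :=
  a ^ ((d : ℝ) / 2) * (2 : ℝ) ^ ((d : ℝ) / 2 - 1) * (d : ℝ) ^ ((d : ℝ) / (2 * (d : ℝ) - 2)) *
    D ^ (-1 / (2 * (d : ℝ) - 2))

/-- `γ(a,d,D)`: `arccos p / d` for odd `d`, `arcsin p / d` for even `d`. -/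
def tanAngle (a : ℝ) (d : ℕ) (D : ℝ) : ℝ :=
  if Odd d then Real.arccos (tanParam a d D) / d else Real.arcsin (tanParam a d D) / d

/-- The points `a tan(γ + kπ/d)`, `k = 0, …, d-1`, with `γ = γ(a,d,D)`. -/
def tanConfig (a : ℝ) (d : ℕ) (D : ℝ) : Fin d → ℝ :=
  fun k => a * Real.tan (tanAngle a d D + (k : ℝ) * Real.pi / d)

/-- The coefficient `binom(d,2k) (2k-1)!! / ∏_{j=1}^k (lam - 2d + 2j + 1)`. -/
def gCoeff (d : ℕ) (lam : ℝ) (k : ℕ) : ℝ :=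
  (d.choose (2 * k) : ℝ) * ((Nat.doubleFactorial (2 * k - 1) : ℕ) : ℝ) /
    ∏ j ∈ Finset.Icc 1 k, (lam - 2 * (d : ℝ) + 2 * (j : ℝ) + 1)

/-- The polynomial `G_{a,lam}` of degree `d`. -/
def gPoly (d : ℕ) (a lam : ℝ) : ℝ[X] :=
  X ^ d + ∑ k ∈ Finset.Icc 1 (d / 2), C ((-1) ^ k * a ^ (2 * k) * gCoeff d lam k) * X ^ (d - 2 * k)

/-- The admissible parameters: `lam > 2d - 2` and
`1 + ∑_{k=1}^{⌊d/2⌋} binom(d,2k) (2k-1)!! / ∏_{j=1}^k (lam - 2d + 2j + 1) = e^{-vd} / a^d`. -/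
def IsEquilibriumParam (d : ℕ) (a v lam : ℝ) : Prop :=
  2 * (d : ℝ) - 2 < lam ∧
    1 + ∑ k ∈ Finset.Icc 1 (d / 2), gCoeff d lam k = Real.exp (-v * d) / a ^ d

end

/-! Exponentiating turns the problem into a multiplicative one. The potential condition fixes `M = ∏
|ai - x_k| = e^{-vd}`, and a lower bound for the energy is an upper bound for the discriminant
`∏_{j≠k} |x_j - x_k|` of `P = ∏ (X - x_k)`.

General bound: the Cayley map `t ↦ (t - ai)/(t + ai)` sends the points to `w_k` on the unit circle
and multiplies `|x_j - x_k|` by `2a / (|x_j + ai| |x_k + ai|)`. The discriminant is therefore `|det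
V(w)|^2` times a constant depending only on `M`. Hadamard's inequality gives `|det V(w)|^2 ≤ d^d`,
with equality exactly when the `w_k` are distinct and share one `d`-th power `c` (`pairProd_le`).

Equality: then `(1 - c) P = (X - ai)^d - c (X + ai)^d`, and evaluating at `ai` gives `|1 - c| M =
(2a)^d`. As `|1 - c| ≤ 2`, this forces `M ≥ a^d 2^{d-1}`, the range of small `v`. There `c` is
determined up to conjugation, which is the reflection `x ↦ -x`, and the tangent points realise it
(`extremal_iff_tanConfig`).

Remaining range: a Lagrange multiplier `λ` is introduced, and discriminant times `M^{-λ}` is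
maximised over all configurations. For `λ > 2d - 2` the general bound makes this tend to `0` at
infinity, so a maximum exists. As in Stieltjes' electrostatics, its critical equations say that `P`
solves a second order differential equation whose only monic solution of degree `d` is `G`. Hence
`G` has simple real roots, and on its own level set of `M` it is the unique maximiser of the
discriminant (`exists_rootPoly_eq_gPoly`). Finally `|G(ai)| / a^d` decreases strictly from `2^{d-1}`
at `λ = 2d - 2` to the limit `1`, so each remaining `M` occurs for exactly one `λ`. -/

noncomputable section

/-! ### Multiplicative form of the potential and the energy -/

/-- The product `∏_{j ≠ k} |x_j - x_k|`, i.e. the discriminant of `∏ (X - x_j)`. -/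
def pairProd {d : ℕ} (x : Fin d → ℝ) : ℝ := ∏ j, ∏ k ∈ Finset.univ.erase j, |x j - x k|

/-- The modulus of `∏ (X - x_k)` at `a i`. -/
def distProd {d : ℕ} (a : ℝ) (x : Fin d → ℝ) : ℝ := ∏ k, ‖(a * Complex.I - x k : ℂ)‖

theorem norm_mul_I_sub_sq (a t : ℝ) : ‖(a * Complex.I - t : ℂ)‖ ^ 2 = t ^ 2 + a ^ 2 := by
  rw [← Complex.normSq_eq_norm_sq, Complex.normSq_apply]
  simp
  ring

theorem norm_mul_I_sub_pos {a : ℝ} (ha : 0 < a) (t : ℝ) : 0 < ‖(a * Complex.I - t : ℂ)‖ := by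
  have h := norm_mul_I_sub_sq a t
  have : 0 < t ^ 2 + a ^ 2 := by positivity
  rw [← h] at this
  exact lt_of_le_of_ne (norm_nonneg _) fun h0 => by simp [← h0] at this

theorem distProd_pos {d : ℕ} {a : ℝ} (ha : 0 < a) (x : Fin d → ℝ) : 0 < distProd a x :=
  Finset.prod_pos fun k _ => norm_mul_I_sub_pos ha (x k)

theorem logPotential_countingMeasure {d : ℕ} (x : Fin d → ℝ) (z : ℂ) :
    logPotential (countingMeasure x) z = -((d : ℝ)⁻¹ * ∑ k, Real.log ‖z - (x k : ℂ)‖) := by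
  unfold logPotential countingMeasure
  rw [MeasureTheory.integral_smul_measure, MeasureTheory.integral_finsetSum_measure]
  · simp
  · intro i _
    exact MeasureTheory.integrable_dirac (by simp)

theorem logPotential_eq_iff {d : ℕ} (hd : 0 < d) {a : ℝ} (ha : 0 < a) (x : Fin d → ℝ) (v : ℝ) :
    logPotential (countingMeasure x) (a * Complex.I) = v ↔
      distProd a x = Real.exp (-v * d) := by
  have hd' : (d : ℝ) ≠ 0 := by positivity
  rw [logPotential_countingMeasure, ← Real.log_prod (fun k _ => (norm_mul_I_sub_pos ha (x k)).ne')]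
  change -((d : ℝ)⁻¹ * Real.log (distProd a x)) = v ↔ _
  rw [← Real.log_injOn_pos.eq_iff (distProd_pos ha x) (Real.exp_pos _), Real.log_exp]
  constructor
  · rintro rfl
    field_simp
  · intro h
    rw [h]
    field_simp

theorem pairProd_nonneg {d : ℕ} (x : Fin d → ℝ) : 0 ≤ pairProd x :=
  Finset.prod_nonneg fun _ _ => Finset.prod_nonneg fun _ _ => abs_nonneg _

theorem pairProd_ne_zero_iff {d : ℕ} (x : Fin d → ℝ) : pairProd x ≠ 0 ↔ Function.Injective x := by
  unfold pairProd
  rw [Finset.prod_ne_zero_iff]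
  simp only [Finset.prod_ne_zero_iff, Finset.mem_univ, Finset.mem_erase, abs_ne_zero, sub_ne_zero]
  constructor
  · intro h i j hij
    by_contra hne
    exact h i trivial j ⟨fun e => hne e.symm, trivial⟩ hij
  · intro h i _ j hj hij
    exact hj.1 (h hij).symm

theorem negLog_ne_bot (r : ℝ) : negLog r ≠ ⊥ := by
  unfold negLog
  split_ifs <;> simp

theorem EReal.coe_finset_sum {ι : Type*} (s : Finset ι) (f : ι → ℝ) :
    ((∑ i ∈ s, f i : ℝ) : EReal) = ∑ i ∈ s, (f i : EReal) := by
  classical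
  induction s using Finset.induction with
  | empty => simp
  | insert i s hi ih => rw [Finset.sum_insert hi, Finset.sum_insert hi, EReal.coe_add, ih]

theorem EReal.finset_sum_ne_bot {ι : Type*} (s : Finset ι) (f : ι → EReal)
    (h : ∀ i ∈ s, f i ≠ ⊥) : ∑ i ∈ s, f i ≠ ⊥ := by
  classical
  induction s using Finset.induction with
  | empty => simp
  | insert i s hi ih =>
    rw [Finset.sum_insert hi]
    exact EReal.add_ne_bot_iff.2 ⟨h i (by simp), ih fun j hj => h j (by simp [hj])⟩

theorem EReal.finset_sum_eq_top {ι : Type*} (s : Finset ι) (f : ι → EReal)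
    (h : ∀ i ∈ s, f i ≠ ⊥) {i : ι} (hi : i ∈ s) (hf : f i = ⊤) : ∑ i ∈ s, f i = ⊤ := by
  classical
  rw [← Finset.add_sum_erase s f hi, hf]
  exact EReal.top_add_of_ne_bot
    (EReal.finset_sum_ne_bot _ _ fun j hj => h j (Finset.mem_of_mem_erase hj))

theorem discreteEnergy_eq {d : ℕ} (hd : 2 ≤ d) (x : Fin d → ℝ) :
    discreteEnergy x = if pairProd x = 0 then ⊤ else
      ((-Real.log (pairProd x) / ((d : ℝ) * ((d : ℝ) - 1)) : ℝ) : EReal) := by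
  have hd' : (2 : ℝ) ≤ d := by exact_mod_cast hd
  have hpos : 0 < (d : ℝ) * ((d : ℝ) - 1) := by nlinarith
  unfold discreteEnergy
  split_ifs with h
  · unfold pairProd at h
    rw [Finset.prod_eq_zero_iff] at h
    obtain ⟨i, hi, h⟩ := h
    obtain ⟨k, hk, h⟩ := Finset.prod_eq_zero_iff.1 h
    rw [EReal.finset_sum_eq_top _ _
      (fun j _ => EReal.finset_sum_ne_bot _ _ fun k _ => negLog_ne_bot _) hi
      (EReal.finset_sum_eq_top _ _ (fun k _ => negLog_ne_bot _) hk (by simp [negLog, h]))]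
    exact EReal.coe_mul_top_of_pos (by positivity)
  · have hne : ∀ j, ∀ k ∈ Finset.univ.erase j, |x j - x k| ≠ 0 := by
      intro j k hk h0
      exact h (Finset.prod_eq_zero (Finset.mem_univ j) (Finset.prod_eq_zero hk h0))
    have hsum : ∑ j, ∑ k ∈ Finset.univ.erase j, negLog |x j - x k| =
        ((-Real.log (pairProd x) : ℝ) : EReal) := by
      unfold pairProd
      rw [Real.log_prod (fun j _ => Finset.prod_ne_zero_iff.2 (hne j)), ← Finset.sum_neg_distrib,
        EReal.coe_finset_sum]
      refine Finset.sum_congr rfl fun j _ => ?_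
      rw [Real.log_prod (hne j), ← Finset.sum_neg_distrib, EReal.coe_finset_sum]
      refine Finset.sum_congr rfl fun k hk => ?_
      rw [negLog, if_neg (hne j k hk)]
    rw [hsum, ← EReal.coe_mul]
    congr 1
    ring

/-- Coinciding points cause no exception: the energy is then `⊤` and the product is `0`, so both
sides hold. -/
theorem le_discreteEnergy_iff {d : ℕ} (hd : 2 ≤ d) (x : Fin d → ℝ) {B : ℝ} (hB : 0 < B) :
    ((-Real.log B / ((d : ℝ) * ((d : ℝ) - 1)) : ℝ) : EReal) ≤ discreteEnergy x ↔
      pairProd x ≤ B := by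
  have hd' : (2 : ℝ) ≤ d := by exact_mod_cast hd
  have hpos : 0 < (d : ℝ) * ((d : ℝ) - 1) := by nlinarith
  rw [discreteEnergy_eq hd]
  split_ifs with h
  · simp [h, hB.le]
  · have h0 : 0 < pairProd x := lt_of_le_of_ne (pairProd_nonneg x) (Ne.symm h)
    rw [EReal.coe_le_coe_iff, div_le_div_iff_of_pos_right hpos, neg_le_neg_iff,
      Real.log_le_log_iff h0 hB]

theorem discreteEnergy_eq_iff {d : ℕ} (hd : 2 ≤ d) (x : Fin d → ℝ) {B : ℝ} (hB : 0 < B) :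
    discreteEnergy x = ((-Real.log B / ((d : ℝ) * ((d : ℝ) - 1)) : ℝ) : EReal) ↔
      pairProd x = B := by
  have hd' : (2 : ℝ) ≤ d := by exact_mod_cast hd
  have hpos : 0 < (d : ℝ) * ((d : ℝ) - 1) := by nlinarith
  rw [discreteEnergy_eq hd]
  split_ifs with h
  · simp [h, hB.ne]
  · have h0 : 0 < pairProd x := lt_of_le_of_ne (pairProd_nonneg x) (Ne.symm h)
    rw [EReal.coe_eq_coe_iff, div_left_inj' hpos.ne', neg_inj, Real.log_injOn_pos.eq_iff h0 hB]

theorem pairProd_eq_sq {d : ℕ} (x : Fin d → ℝ) :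
    pairProd x = (∏ i : Fin d, ∏ j ∈ Finset.Ioi i, |x j - x i|) ^ 2 := by
  have h := Finset.prod_prod_Ioi_mul_eq_prod_prod_off_diag fun i j : Fin d => |x j - x i|
  unfold pairProd
  simp only [← Finset.compl_singleton]
  rw [← h, ← Finset.prod_pow]
  refine Finset.prod_congr rfl fun i _ => ?_
  rw [← Finset.prod_pow]
  refine Finset.prod_congr rfl fun j _ => ?_
  rw [abs_sub_comm (x i) (x j), sq]

/-! ### Root polynomials and their discriminants -/

/-- The monic polynomial with the given roots. -/
def rootPoly {d : ℕ} (x : Fin d → ℝ) : ℝ[X] := ∏ k, (X - C (x k))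

theorem rootPoly_monic {d : ℕ} (x : Fin d → ℝ) : (rootPoly x).Monic :=
  monic_prod_of_monic _ _ fun k _ => monic_X_sub_C (x k)

theorem rootPoly_natDegree {d : ℕ} (x : Fin d → ℝ) : (rootPoly x).natDegree = d := by
  simp [rootPoly]

theorem rootPoly_splits {d : ℕ} (x : Fin d → ℝ) : (rootPoly x).Splits :=
  Splits.prod fun k _ => Splits.X_sub_C (x k)

theorem rootPoly_eq_multiset_prod {d : ℕ} (x : Fin d → ℝ) :
    rootPoly x = ((pointMultiset x).map fun t => X - C t).prod := by
  unfold rootPoly pointMultiset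
  rw [Multiset.map_map]
  rfl

theorem rootPoly_roots {d : ℕ} (x : Fin d → ℝ) : (rootPoly x).roots = pointMultiset x := by
  rw [rootPoly_eq_multiset_prod, roots_multiset_prod_X_sub_C]

theorem pointMultiset_eq_iff {d : ℕ} (x y : Fin d → ℝ) :
    pointMultiset x = pointMultiset y ↔ rootPoly x = rootPoly y := by
  constructor
  · intro h
    rw [rootPoly_eq_multiset_prod, h, ← rootPoly_eq_multiset_prod]
  · intro h
    rw [← rootPoly_roots, h, rootPoly_roots]

theorem rootPoly_eq_mul {d : ℕ} (x : Fin d → ℝ) (i : Fin d) :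
    rootPoly x = (X - C (x i)) * ∏ k ∈ Finset.univ.erase i, (X - C (x k)) :=
  (Finset.mul_prod_erase _ (fun k => X - C (x k)) (Finset.mem_univ i)).symm

theorem eval_derivative_rootPoly {d : ℕ} (x : Fin d → ℝ) (i : Fin d) :
    (derivative (rootPoly x)).eval (x i) = ∏ k ∈ Finset.univ.erase i, (x i - x k) := by
  rw [rootPoly_eq_mul x i, derivative_mul]
  simp [eval_prod]

/-- The resultant of `P` and `P'` is the product of the values `P'(x_i) = ∏_{k≠i} (x_i - x_k)`.
Pairing `(i, j)` with `(j, i)` yields one sign per pair, which cancels the sign relating resultant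
and discriminant. -/
theorem discr_rootPoly {d : ℕ} (hd : 2 ≤ d) (x : Fin d → ℝ) :
    (rootPoly x).discr = pairProd x := by
  have hdeg : 0 < (rootPoly x).degree := by
    rw [← natDegree_pos_iff_degree_pos, rootPoly_natDegree]; lia
  have h := resultant_deriv hdeg
  rw [resultant_eq_prod_eval _ _ _ (natDegree_derivative_le _) (rootPoly_splits x),
    (rootPoly_monic x).leadingCoeff, one_pow, one_mul, mul_one, rootPoly_roots,
    rootPoly_natDegree] at h
  have h1 : ((pointMultiset x).map fun t => (derivative (rootPoly x)).eval t).prod =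
      ∏ i, ∏ k ∈ Finset.univ.erase i, (x i - x k) := by
    unfold pointMultiset
    rw [Multiset.map_map, Finset.prod_eq_multiset_prod]
    simp [eval_derivative_rootPoly]
  have h2 : ∏ i, ∏ k ∈ Finset.univ.erase i, (x i - x k) =
      (-1) ^ (d * (d - 1) / 2) * pairProd x := by
    have h := Finset.prod_prod_Ioi_mul_eq_prod_prod_off_diag fun i j : Fin d => x j - x i
    simp only [← Finset.compl_singleton]
    rw [← h, pairProd_eq_sq]
    have h3 : ∀ i j : Fin d, (x i - x j) * (x j - x i) = (-1) * |x j - x i| ^ 2 := by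
      intro i j
      rw [sq_abs]; ring
    simp_rw [h3, Finset.prod_mul_distrib, Finset.prod_pow, Finset.prod_const]
    congr 1
    rw [Finset.prod_pow_eq_pow_sum]
    congr 1
    simp only [Fin.card_Ioi]
    rw [Fin.sum_univ_eq_sum_range (fun i => d - 1 - i) d, Finset.sum_range_reflect (fun i => i) d,
      Finset.sum_range_id]
  change ((pointMultiset x).map fun t => (derivative (rootPoly x)).eval t).prod = _ at h
  rw [h1, h2] at h
  exact (mul_left_cancel₀ (by simp) h).symm

/-! ### Hadamard's inequality and Vandermonde determinants on the unit circle -/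

theorem prod_le_one_of_sum_eq_card {ι : Type*} [Fintype ι] (f : ι → ℝ) (hf : ∀ i, 0 ≤ f i)
    (hs : ∑ i, f i = Fintype.card ι) : ∏ i, f i ≤ 1 ∧ (∏ i, f i = 1 → ∀ i, f i = 1) := by
  have hexp : ∏ i, Real.exp (f i - 1) = 1 := by
    rw [← Real.exp_sum, Finset.sum_sub_distrib, hs]
    simp
  -- AM-GM in the form `t ≤ exp (t - 1)`, strict for `t ≠ 1`; the exponentials multiply to `1`.
  have hle : ∀ i, f i ≤ Real.exp (f i - 1) := fun i => by
    simpa using Real.add_one_le_exp (f i - 1)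
  refine ⟨hexp ▸ Finset.prod_le_prod (fun i _ => hf i) fun i _ => hle i, fun h i => ?_⟩
  by_contra hne
  have hpos : ∀ j, 0 < f j := fun j => lt_of_le_of_ne (hf j) fun h0 => by
    rw [Finset.prod_eq_zero (Finset.mem_univ j) h0.symm] at h
    exact zero_ne_one h
  have hlt : ∏ j, f j < ∏ j, Real.exp (f j - 1) := by
    refine Finset.prod_lt_prod (fun j _ => hpos j) (fun j _ => hle j) ⟨i, Finset.mem_univ i, ?_⟩
    simpa using Real.add_one_lt_exp (sub_ne_zero.2 hne)
  rw [h, hexp] at hlt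
  exact lt_irrefl _ hlt

open scoped ComplexOrder in
/-- Hadamard's inequality for positive semidefinite matrices with constant diagonal. -/
theorem Matrix.PosSemidef.norm_det_le_of_diag_eq {n : Type*} [Fintype n] [DecidableEq n]
    {A : Matrix n n ℂ} (hA : A.PosSemidef) {c : ℝ} (hc : 0 < c) (hdiag : ∀ i, A i i = c) :
    ‖A.det‖ ≤ c ^ Fintype.card n ∧
      (‖A.det‖ = c ^ Fintype.card n → A = (c : ℂ) • (1 : Matrix n n ℂ)) := by
  have hsum : ∑ i, hA.1.eigenvalues i = Fintype.card n * c := by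
    have h := hA.1.trace_eq_sum_eigenvalues
    rw [Matrix.trace] at h
    simp only [Matrix.diag_apply, hdiag, Finset.sum_const, Finset.card_univ, nsmul_eq_mul] at h
    have h' : ((Fintype.card n * c : ℝ) : ℂ) = ((∑ i, hA.1.eigenvalues i : ℝ) : ℂ) := by
      push_cast
      exact h
    exact (Complex.ofReal_injective h').symm
  have hdet : ‖A.det‖ = c ^ Fintype.card n * ∏ i, hA.1.eigenvalues i / c := by
    rw [hA.1.det_eq_prod_eigenvalues, norm_prod, Finset.prod_div_distrib, Finset.prod_const,
      Finset.card_univ, mul_div_cancel₀ _ (pow_ne_zero _ hc.ne')]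
    refine Finset.prod_congr rfl fun i _ => ?_
    simp [abs_of_nonneg (hA.eigenvalues_nonneg i)]
  -- The trace is `n c`, so the eigenvalues divided by `c` have mean `1`. If their product is `1`,
  -- all eigenvalues equal `c`, and conjugating a scalar matrix changes nothing.
  obtain ⟨h1, h2⟩ := prod_le_one_of_sum_eq_card (fun i => hA.1.eigenvalues i / c)
    (fun i => div_nonneg (hA.eigenvalues_nonneg i) hc.le)
    (by rw [← Finset.sum_div, hsum, mul_div_cancel_right₀ _ hc.ne'])
  have hcp : 0 < c ^ Fintype.card n := pow_pos hc _
  rw [hdet]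
  refine ⟨by nlinarith, fun h => ?_⟩
  have h3 := h2 (by simpa using (mul_eq_left₀ hcp.ne').1 h)
  have h4 : (fun i => ((hA.1.eigenvalues i : ℝ) : ℂ)) = fun _ => (c : ℂ) := by
    funext i
    rw [(div_eq_one_iff_eq hc.ne').1 (h3 i)]
  have hsp := hA.1.spectral_theorem
  have h5 : (Matrix.diagonal (RCLike.ofReal ∘ hA.1.eigenvalues) : Matrix n n ℂ) =
      (c : ℂ) • (1 : Matrix n n ℂ) := by
    rw [Matrix.smul_one_eq_diagonal]
    exact congrArg _ h4
  rw [h5, map_smul, map_one] at hsp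
  exact hsp

theorem vandermonde_mul_conjTranspose_apply {d : ℕ} (w : Fin d → ℂ) (hw : ∀ i, ‖w i‖ = 1)
    (i j : Fin d) : (Matrix.vandermonde w * (Matrix.vandermonde w).conjTranspose) i j =
      ∑ m ∈ Finset.range d, (w i / w j) ^ m := by
  rw [Matrix.mul_apply, ← Fin.sum_univ_eq_sum_range (fun m => (w i / w j) ^ m)]
  refine Finset.sum_congr rfl fun m _ => ?_
  have hj : w j ≠ 0 := fun h => by simpa [h] using hw j
  rw [Matrix.conjTranspose_apply, Matrix.vandermonde_apply, Matrix.vandermonde_apply, star_pow,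
    ← mul_pow, div_eq_mul_inv, Complex.star_def, Complex.inv_eq_conj (hw j)]

-- The Gram matrix `V V*` has diagonal entries `d` and off-diagonal entries the geometric sums of
-- `w_i / w_j`. Equality in Hadamard means that these sums vanish, so every ratio is a `d`-th root
-- of unity other than `1`.
open scoped ComplexOrder in
theorem norm_det_vandermonde_le {d : ℕ} (hd : 0 < d) (w : Fin d → ℂ) (hw : ∀ i, ‖w i‖ = 1) :
    ‖(Matrix.vandermonde w).det‖ ^ 2 ≤ (d : ℝ) ^ d ∧
    (‖(Matrix.vandermonde w).det‖ ^ 2 = (d : ℝ) ^ d ↔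
      Function.Injective w ∧ ∀ i j, w i ^ d = w j ^ d) := by
  have hd' : (0 : ℝ) < d := by exact_mod_cast hd
  have hw0 : ∀ i, w i ≠ 0 := fun i h => by simpa [h] using hw i
  set A := Matrix.vandermonde w * (Matrix.vandermonde w).conjTranspose with hA
  have hdet : ‖A.det‖ = ‖(Matrix.vandermonde w).det‖ ^ 2 := by
    rw [hA, Matrix.det_mul, Matrix.det_conjTranspose, norm_mul, norm_star, sq]
  have hdiag : ∀ i, A i i = ((d : ℝ) : ℂ) := fun i => by
    rw [hA, vandermonde_mul_conjTranspose_apply w hw, div_self (hw0 i)]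
    simp
  obtain ⟨h1, h2⟩ :=
    (Matrix.posSemidef_self_mul_conjTranspose (Matrix.vandermonde w)).norm_det_le_of_diag_eq
      hd' hdiag
  rw [← hA, hdet, Fintype.card_fin] at h1 h2
  refine ⟨h1, fun h => ?_, fun ⟨hinj, hpow⟩ => ?_⟩
  · have hinj : Function.Injective w := by
      rw [← Matrix.det_vandermonde_ne_zero_iff]
      intro h0
      rw [h0] at h
      have : (0 : ℝ) < (d : ℝ) ^ d := by positivity
      rw [norm_zero, zero_pow two_ne_zero] at h
      exact this.ne h
    refine ⟨hinj, fun i j => ?_⟩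
    by_cases hij : i = j
    · rw [hij]
    have h3 := congrFun (congrFun (h2 h) i) j
    rw [hA, vandermonde_mul_conjTranspose_apply w hw] at h3
    simp [hij] at h3
    have h4 := geom_sum_mul (w i / w j) d
    rw [h3, zero_mul, div_pow] at h4
    exact (div_eq_one_iff_eq (pow_ne_zero _ (hw0 j))).1 (sub_eq_zero.1 h4.symm)
  · have h3 : A = ((d : ℝ) : ℂ) • (1 : Matrix (Fin d) (Fin d) ℂ) := by
      ext i j
      by_cases hij : i = j
      · subst hij
        rw [hdiag]
        simp
      · have hne : w i / w j - 1 ≠ 0 := by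
          rw [sub_ne_zero, Ne, div_eq_one_iff_eq (hw0 j)]
          exact fun h => hij (hinj h)
        rw [hA, vandermonde_mul_conjTranspose_apply w hw]
        have h4 := geom_sum_mul (w i / w j) d
        rw [div_pow, hpow i j, div_self (pow_ne_zero _ (hw0 j)), sub_self] at h4
        rw [(mul_eq_zero.1 h4).resolve_right hne]
        simp [hij]
    rw [← hdet, h3]
    simp

/-! ### The Cayley transform and the general bound -/

/-- The Cayley transform of the real line onto the unit circle. -/
def cayleyPoint (a t : ℝ) : ℂ := (t - a * Complex.I) / (t + a * Complex.I)

theorem ofReal_add_mul_I_ne_zero {a : ℝ} (ha : a ≠ 0) (t : ℝ) : (t + a * Complex.I : ℂ) ≠ 0 := by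
  intro h
  have := congrArg Complex.im h
  simp [ha] at this

theorem conj_ofReal_add_mul_I (a t : ℝ) :
    (starRingEnd ℂ) (t + a * Complex.I) = t - a * Complex.I := by
  simp [sub_eq_add_neg]

theorem norm_ofReal_add_mul_I (a t : ℝ) :
    ‖(t + a * Complex.I : ℂ)‖ = ‖(a * Complex.I - t : ℂ)‖ := by
  rw [← Complex.norm_conj, conj_ofReal_add_mul_I, norm_sub_rev]

theorem norm_cayleyPoint {a : ℝ} (ha : a ≠ 0) (t : ℝ) : ‖cayleyPoint a t‖ = 1 := by
  unfold cayleyPoint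
  rw [norm_div, ← conj_ofReal_add_mul_I, Complex.norm_conj, div_self]
  exact norm_ne_zero_iff.2 (ofReal_add_mul_I_ne_zero ha t)

theorem cayleyPoint_sub {a : ℝ} (ha : a ≠ 0) (s t : ℝ) : cayleyPoint a s - cayleyPoint a t =
    2 * a * Complex.I * (s - t) / ((s + a * Complex.I) * (t + a * Complex.I)) := by
  have h1 := ofReal_add_mul_I_ne_zero ha s
  have h2 := ofReal_add_mul_I_ne_zero ha t
  unfold cayleyPoint
  rw [div_sub_div _ _ h1 h2]
  congr 1
  ring

theorem cayleyPoint_injective {a : ℝ} (ha : a ≠ 0) : Function.Injective (cayleyPoint a) := by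
  intro s t h
  rw [← sub_eq_zero, cayleyPoint_sub ha, div_eq_zero_iff] at h
  rcases h with h | h
  · have : (s - t : ℂ) = 0 := by simpa [ha] using h
    exact_mod_cast sub_eq_zero.1 this
  · exact absurd h (mul_ne_zero (ofReal_add_mul_I_ne_zero ha s) (ofReal_add_mul_I_ne_zero ha t))

theorem cayleyPoint_neg (a t : ℝ) :
    cayleyPoint a (-t) = (starRingEnd ℂ) (cayleyPoint a t) := by
  have h : (starRingEnd ℂ) (t - a * Complex.I) = t + a * Complex.I := by
    rw [← conj_ofReal_add_mul_I, Complex.conj_conj]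
  unfold cayleyPoint
  rw [map_div₀, conj_ofReal_add_mul_I, h, ← neg_div_neg_eq]
  push_cast
  congr 1 <;> ring

/-- `cayleyPoint_sub` is applied to each pair; every point lies in `d - 1` pairs, and squaring the
determinant doubles this exponent. -/
theorem norm_det_vandermonde_cayleyPoint {d : ℕ} {a : ℝ} (ha : 0 < a) (x : Fin d → ℝ) :
    ‖(Matrix.vandermonde fun k => cayleyPoint a (x k)).det‖ ^ 2 * distProd a x ^ (2 * (d - 1)) =
      (2 * a) ^ (d * (d - 1)) * pairProd x := by
  have hn : ∀ t, ‖(a * Complex.I - (t : ℝ) : ℂ)‖ ≠ 0 := fun t => (norm_mul_I_sub_pos ha t).ne'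
  have hoff := Finset.prod_prod_Ioi_mul_eq_prod_prod_off_diag fun i j : Fin d =>
    ‖(a * Complex.I - (x j : ℝ) : ℂ)‖
  have hdist : distProd a x ^ (d - 1) = ∏ i : Fin d, ∏ j ∈ Finset.Ioi i,
      (‖(a * Complex.I - (x i : ℝ) : ℂ)‖ * ‖(a * Complex.I - (x j : ℝ) : ℂ)‖) := by
    rw [hoff, distProd, ← Finset.prod_pow]
    refine Finset.prod_congr rfl fun i _ => ?_
    rw [Finset.prod_const, Finset.card_compl, Finset.card_singleton, Fintype.card_fin]
  have hpow : ((2 * a) ^ (d * (d - 1)) : ℝ) =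
      (∏ i : Fin d, ∏ j ∈ Finset.Ioi i, (2 * a)) ^ 2 := by
    have := Finset.prod_prod_Ioi_mul_eq_prod_prod_off_diag fun i j : Fin d => 2 * a
    rw [← Finset.prod_pow]
    simp_rw [← Finset.prod_pow, sq, this]
    simp [Finset.prod_const, Finset.card_compl, ← pow_mul, mul_comm]
  rw [mul_comm 2 (d - 1), pow_mul, hdist, hpow, pairProd_eq_sq, Matrix.det_vandermonde,
    ← mul_pow, ← mul_pow]
  congr 1
  simp_rw [norm_prod, ← Finset.prod_mul_distrib]
  refine Finset.prod_congr rfl fun i _ => Finset.prod_congr rfl fun j _ => ?_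
  rw [cayleyPoint_sub ha.ne', norm_div, norm_mul, norm_mul (_ + _), norm_ofReal_add_mul_I,
    norm_ofReal_add_mul_I, ← Complex.ofReal_sub, Complex.norm_real, Real.norm_eq_abs]
  have h1 := hn (x i)
  have h2 := hn (x j)
  have h3 : ‖(2 * a * Complex.I : ℂ)‖ = 2 * a := by simp [ha.le]
  rw [h3]
  field_simp

theorem pairProd_le {d : ℕ} (hd : 0 < d) {a : ℝ} (ha : 0 < a) (x : Fin d → ℝ) :
    pairProd x ≤ distProd a x ^ (2 * (d - 1)) * (d : ℝ) ^ d / (2 * a) ^ (d * (d - 1)) ∧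
    (pairProd x = distProd a x ^ (2 * (d - 1)) * (d : ℝ) ^ d / (2 * a) ^ (d * (d - 1)) ↔
      Function.Injective x ∧ ∀ i j, cayleyPoint a (x i) ^ d = cayleyPoint a (x j) ^ d) := by
  obtain ⟨h1, h2⟩ := norm_det_vandermonde_le hd (fun k => cayleyPoint a (x k))
    fun k => norm_cayleyPoint ha.ne' (x k)
  have h3 := norm_det_vandermonde_cayleyPoint ha x
  have hN : 0 < distProd a x ^ (2 * (d - 1)) := pow_pos (distProd_pos ha x) _
  have hA : 0 < (2 * a) ^ (d * (d - 1)) := by positivity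
  rw [show (fun k => cayleyPoint a (x k)) = cayleyPoint a ∘ x from rfl,
    (cayleyPoint_injective ha.ne').of_comp_iff] at h2
  rw [← h2, le_div_iff₀ hA, eq_div_iff hA.ne', mul_comm (pairProd x), ← h3,
    mul_comm (distProd a x ^ (2 * (d - 1))), mul_le_mul_iff_left₀ hN,
    mul_left_inj' hN.ne']
  exact ⟨h1, Iff.rfl⟩

/-! ### The equality case: tangent configurations -/

theorem tanParam_eq {d : ℕ} (hd : 2 ≤ d) {a M : ℝ} (ha : 0 < a) (hM : 0 < M) :
    tanParam a d (M ^ (2 * d - 2) * (d : ℝ) ^ d / (2 * a) ^ (d * (d - 1))) =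
      a ^ d * 2 ^ (d - 1) / M := by
  have hd' : (2 : ℝ) ≤ d := by exact_mod_cast hd
  have hd0 : (0 : ℝ) < d := by linarith
  have hc : ((2 * d - 2 : ℕ) : ℝ) = 2 * d - 2 := by
    rw [Nat.cast_sub (by lia)]; push_cast; ring
  have hc1 : ((d - 1 : ℕ) : ℝ) = d - 1 := by
    rw [Nat.cast_sub (by lia)]; push_cast; ring
  have hne : (2 * (d : ℝ) - 2) ≠ 0 := by linarith
  have hne' : ((d : ℝ) - 1) ≠ 0 := by linarith
  set D := M ^ (2 * d - 2) * (d : ℝ) ^ d / (2 * a) ^ (d * (d - 1)) with hD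
  have hDpos : 0 < D := by positivity
  have hlogD : Real.log D = (2 * d - 2) * Real.log M + d * Real.log d -
      d * (d - 1) * (Real.log 2 + Real.log a) := by
    rw [hD, Real.log_div (by positivity) (by positivity),
      Real.log_mul (by positivity) (by positivity), Real.log_pow, Real.log_pow, Real.log_pow,
      Real.log_mul two_ne_zero ha.ne', hc, Nat.cast_mul, hc1]
  unfold tanParam
  refine Real.log_injOn_pos (Set.mem_Ioi.2 (by positivity)) (Set.mem_Ioi.2 (by positivity)) ?_
  rw [Real.log_mul (by positivity) (by positivity), Real.log_mul (by positivity) (by positivity),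
    Real.log_mul (by positivity) (by positivity), Real.log_rpow ha, Real.log_rpow two_pos,
    Real.log_rpow hd0, Real.log_rpow hDpos, hlogD, Real.log_div (by positivity) hM.ne',
    Real.log_mul (by positivity) (by positivity), Real.log_pow, Real.log_pow, hc1]
  field_simp
  ring

theorem cayleyPoint_mul_tan {a θ : ℝ} (ha : a ≠ 0) (hθ : Real.cos θ ≠ 0) :
    cayleyPoint a (a * Real.tan θ) = -Complex.exp (2 * θ * Complex.I) := by
  have hc : (Real.cos θ : ℂ) ≠ 0 := by exact_mod_cast hθ
  have hne := ofReal_add_mul_I_ne_zero ha (a * Real.tan θ)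
  have he : Complex.exp (2 * θ * Complex.I) =
      (Real.cos θ + Real.sin θ * Complex.I) ^ 2 := by
    rw [mul_assoc, two_mul, Complex.exp_add, Complex.exp_mul_I]
    push_cast
    ring
  have h1 : (Real.sin θ : ℂ) ^ 2 + (Real.cos θ : ℂ) ^ 2 = 1 := by
    exact_mod_cast Real.sin_sq_add_cos_sq θ
  unfold cayleyPoint
  rw [div_eq_iff hne, he, Real.tan_eq_sin_div_cos]
  push_cast at hc h1 ⊢
  field_simp
  have hI := Complex.I_sq
  generalize Complex.I = i at *
  generalize Complex.sin θ = s at *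
  generalize Complex.cos θ = c at *
  linear_combination a * ((2 * s * c ^ 2 + s ^ 2 * c * i + s ^ 3) * hI + (c * i - s) * h1)

/-- Both sides have degree at most `d` and the same coefficient `1 - c` at `X^d`, and they agree at
the `d` distinct points `x_k`, where both vanish. -/
theorem map_rootPoly_eq {d : ℕ} {a : ℝ} (ha : a ≠ 0) {x : Fin d → ℝ}
    (hx : Function.Injective x) {c : ℂ} (hc : ∀ k, cayleyPoint a (x k) ^ d = c) :
    C (1 - c) * (rootPoly x).map Complex.ofRealHom =
      (X - C (a * Complex.I)) ^ d - C c * (X + C (a * Complex.I)) ^ d := by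
  set P := (rootPoly x).map Complex.ofRealHom with hP
  have hPm : P.Monic := (rootPoly_monic x).map _
  have hPd : P.degree = d := by
    rw [hP, degree_map, degree_eq_natDegree (rootPoly_monic x).ne_zero, rootPoly_natDegree]
  have hlt : ∀ Q : ℂ[X], Q.Monic → Q.natDegree = d → (Q - P).degree < d := by
    intro Q hQ hQd
    have h1 : Q.degree = d := by rw [degree_eq_natDegree hQ.ne_zero, hQd]
    rw [← h1]
    exact degree_sub_lt_left (h1.trans hPd.symm) hQ.ne_zero
      (hQ.leadingCoeff.trans hPm.leadingCoeff.symm)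
  have h1 := hlt ((X - C (a * Complex.I)) ^ d) ((monic_X_sub_C _).pow d)
    (by rw [natDegree_pow, natDegree_X_sub_C, mul_one])
  have h2 := hlt ((X + C (a * Complex.I)) ^ d) ((monic_X_add_C _).pow d)
    (by rw [natDegree_pow, natDegree_X_add_C, mul_one])
  have hdeg : (C (1 - c) * P - ((X - C (a * Complex.I)) ^ d -
      C c * (X + C (a * Complex.I)) ^ d)).degree < (d : WithBot ℕ) := by
    have : C (1 - c) * P - ((X - C (a * Complex.I)) ^ d - C c * (X + C (a * Complex.I)) ^ d) =
        C c * ((X + C (a * Complex.I)) ^ d - P) - ((X - C (a * Complex.I)) ^ d - P) := by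
      rw [C_sub, C_1]; ring
    rw [this]
    refine (degree_sub_le _ _).trans_lt (max_lt ?_ h1)
    refine lt_of_le_of_lt ?_ h2
    rw [← smul_eq_C_mul]
    exact degree_smul_le _ _
  refine eq_of_degree_sub_lt_of_eval_index_eq (v := fun k => ((x k : ℝ) : ℂ)) Finset.univ
    (fun i _ j _ h => hx (Complex.ofReal_injective h)) (by simpa using hdeg) fun k _ => ?_
  have hroot : P.eval ((x k : ℝ) : ℂ) = 0 := by
    have h0 : (rootPoly x).eval (x k) = 0 := by
      rw [rootPoly_eq_mul x k]; simp
    have := eval_map_apply (f := Complex.ofRealHom) (p := rootPoly x) (x k)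
    rw [h0] at this
    simpa using this
  have hk := hc k
  rw [cayleyPoint, div_pow, div_eq_iff (pow_ne_zero _ (ofReal_add_mul_I_ne_zero ha _))] at hk
  simp [hroot, hk]

theorem norm_eval_map_rootPoly {d : ℕ} (a : ℝ) (x : Fin d → ℝ) :
    ‖((rootPoly x).map Complex.ofRealHom).eval (a * Complex.I)‖ = distProd a x := by
  unfold rootPoly distProd
  simp [Polynomial.map_prod, eval_prod, norm_prod]

theorem distProd_eq_of_rootPoly_eq {d : ℕ} (a : ℝ) {x y : Fin d → ℝ}
    (h : rootPoly x = rootPoly y) : distProd a x = distProd a y := by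
  rw [← norm_eval_map_rootPoly, h, norm_eval_map_rootPoly]

/-- Evaluation of `map_rootPoly_eq` at `ai` kills the term `(X - ai)^d`. This ties `c` to the
potential and excludes `c = 1`. -/
theorem norm_one_sub_mul_distProd {d : ℕ} (hd : 0 < d) {a : ℝ} (ha : 0 < a) {x : Fin d → ℝ}
    (hx : Function.Injective x) {c : ℂ} (hc : ∀ k, cayleyPoint a (x k) ^ d = c) :
    ‖1 - c‖ * distProd a x = (2 * a) ^ d := by
  have hnc : ‖c‖ = 1 := by
    rw [← hc ⟨0, hd⟩, norm_pow, norm_cayleyPoint ha.ne', one_pow]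
  have h := congrArg (fun P => ‖P.eval (a * Complex.I : ℂ)‖) (map_rootPoly_eq ha.ne' hx hc)
  simp only [eval_mul, eval_C, norm_mul, norm_eval_map_rootPoly] at h
  rw [h]
  simp only [eval_sub, eval_pow, eval_X, eval_C, eval_mul, eval_add, sub_self, zero_pow hd.ne',
    zero_sub, norm_neg, norm_mul, hnc, one_mul, norm_pow, ← two_mul]
  simp [abs_of_pos ha]

theorem rootPoly_eq_of_cayleyPoint_pow_eq {d : ℕ} (hd : 0 < d) {a : ℝ} (ha : 0 < a)
    {x y : Fin d → ℝ} (hx : Function.Injective x) (hy : Function.Injective y) {c : ℂ}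
    (hcx : ∀ k, cayleyPoint a (x k) ^ d = c) (hcy : ∀ k, cayleyPoint a (y k) ^ d = c) :
    rootPoly x = rootPoly y := by
  have hne : 1 - c ≠ 0 := by
    intro h
    have := norm_one_sub_mul_distProd hd ha hx hcx
    rw [h, norm_zero, zero_mul] at this
    exact absurd this.symm (by positivity)
  have h := (map_rootPoly_eq ha.ne' hx hcx).trans (map_rootPoly_eq ha.ne' hy hcy).symm
  exact map_injective _ Complex.ofReal_injective (mul_left_cancel₀ (C_ne_zero.2 hne) h)

theorem eq_or_eq_conj_of_norm_one_sub_eq {c e : ℂ} (hc : ‖c‖ = 1) (he : ‖e‖ = 1)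
    (h : ‖1 - c‖ = ‖1 - e‖) : c = e ∨ c = (starRingEnd ℂ) e := by
  have h1 : ∀ z : ℂ, ‖z‖ = 1 → z.re * z.re + z.im * z.im = 1 := fun z hz => by
    rw [← Complex.normSq_apply, Complex.normSq_eq_norm_sq, hz, one_pow]
  have h2 : ∀ z : ℂ, ‖z‖ = 1 → ‖1 - z‖ ^ 2 = 2 - 2 * z.re := fun z hz => by
    rw [← Complex.normSq_eq_norm_sq, Complex.normSq_apply]
    have := h1 z hz
    simp
    linarith
  have hre : c.re = e.re := by
    have := h2 c hc
    rw [h, h2 e he] at this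
    linarith
  have him : (c.im - e.im) * (c.im + e.im) = 0 := by
    have h3 := h1 c hc
    have h4 := h1 e he
    rw [hre] at h3
    linarith
  rcases mul_eq_zero.1 him with h3 | h3
  · exact Or.inl (Complex.ext hre (by linarith))
  · exact Or.inr (Complex.ext (by simpa using hre) (by simp; linarith))

/-- Factoring out a phase, with `φ = dγ`, leaves `2 cos φ` for odd `d` and `2i sin φ` for even `d`
up to sign. This is the origin of the two cases `arccos` and `arcsin`. -/
theorem norm_one_sub_neg_one_pow_mul_exp_tanAngle {d : ℕ} (hd : 0 < d) {a D : ℝ}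
    (h0 : 0 ≤ tanParam a d D) (h1 : tanParam a d D ≤ 1) :
    ‖1 - (-1) ^ d * Complex.exp (2 * tanAngle a d D * Complex.I) ^ d‖ = 2 * tanParam a d D := by
  have hd' : (d : ℝ) ≠ 0 := by positivity
  set p := tanParam a d D with hp
  have hexp : Complex.exp (2 * tanAngle a d D * Complex.I) ^ d =
      Complex.exp ((d * tanAngle a d D : ℝ) * Complex.I) ^ 2 := by
    rw [← Complex.exp_nat_mul, ← Complex.exp_nat_mul]
    congr 1
    push_cast
    ring
  have hfac : ∀ φ : ℝ, ∀ s : ℂ, 1 - s * Complex.exp (φ * Complex.I) ^ 2 =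
      Complex.exp (φ * Complex.I) *
        (Complex.exp (-φ * Complex.I) - s * Complex.exp (φ * Complex.I)) := by
    intro φ s
    have : Complex.exp (φ * Complex.I) * Complex.exp (-φ * Complex.I) = 1 := by
      rw [← Complex.exp_add]
      simp
    linear_combination -this
  rw [hexp, hfac, norm_mul, Complex.norm_exp_ofReal_mul_I, one_mul]
  unfold tanAngle
  rw [← hp]
  split_ifs with hodd
  · rw [hodd.neg_one_pow, mul_div_cancel₀ _ hd']
    have h2 := Complex.two_cos (Real.arccos p : ℂ)
    rw [← Complex.ofReal_cos, Real.cos_arccos (by linarith) h1] at h2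
    rw [show ∀ u v : ℂ, u - -1 * v = v + u by intros; ring, ← h2]
    simp [abs_of_nonneg h0]
  · rw [(Nat.not_odd_iff_even.1 hodd).neg_one_pow, mul_div_cancel₀ _ hd', one_mul]
    have h2 := Complex.two_sin (Real.arcsin p : ℂ)
    rw [← Complex.ofReal_sin, Real.sin_arcsin (by linarith) h1] at h2
    have h3 := congrArg norm h2
    rw [norm_mul, norm_mul _ Complex.I, Complex.norm_I, mul_one] at h3
    rw [← h3]
    simp [abs_of_nonneg h0]

theorem tanConfig_spec {d : ℕ} (hd : 0 < d) {a D : ℝ} (ha : 0 < a)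
    (h0 : 0 < tanParam a d D) (h1 : tanParam a d D ≤ 1) :
    Function.Injective (tanConfig a d D) ∧
    ∀ k, cayleyPoint a (tanConfig a d D k) ^ d =
      (-1) ^ d * Complex.exp (2 * tanAngle a d D * Complex.I) ^ d := by
  have hdC : (d : ℂ) ≠ 0 := by exact_mod_cast hd.ne'
  set γ := tanAngle a d D with hγ
  have hζ := Complex.isPrimitiveRoot_exp d hd.ne'
  set ζ := Complex.exp (2 * Real.pi * Complex.I / d) with hζd
  have hexp : ∀ k : Fin d, Complex.exp (2 * ((γ + (k : ℝ) * Real.pi / d : ℝ) : ℂ) * Complex.I) =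
      Complex.exp (2 * γ * Complex.I) * ζ ^ (k : ℕ) := by
    intro k
    rw [hζd, ← Complex.exp_nat_mul, ← Complex.exp_add]
    congr 1
    push_cast
    field_simp
  have hpow : ∀ k : Fin d,
      Complex.exp (2 * ((γ + (k : ℝ) * Real.pi / d : ℝ) : ℂ) * Complex.I) ^ d =
      Complex.exp (2 * γ * Complex.I) ^ d := by
    intro k
    rw [hexp, mul_pow, ← pow_mul, mul_comm (k : ℕ) d, pow_mul, hζ.pow_eq_one, one_pow, mul_one]
  -- No tangent is taken at a pole, where `Real.tan` has a default value: a pole would make the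
  -- common `d`-th power equal to `1`, against `p > 0`.
  have hcos : ∀ k : Fin d, Real.cos (γ + (k : ℝ) * Real.pi / d) ≠ 0 := by
    intro k hk
    have he : Complex.exp (2 * ((γ + (k : ℝ) * Real.pi / d : ℝ) : ℂ) * Complex.I) = -1 := by
      have hs : Real.sin (γ + (k : ℝ) * Real.pi / d) ^ 2 = 1 := by
        have := Real.sin_sq_add_cos_sq (γ + (k : ℝ) * Real.pi / d)
        rw [hk] at this
        linarith
      rw [mul_assoc, two_mul, Complex.exp_add, Complex.exp_mul_I, ← Complex.ofReal_cos,
        ← Complex.ofReal_sin, hk]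
      have hs' : (Real.sin (γ + (k : ℝ) * Real.pi / d) : ℂ) ^ 2 = 1 := by exact_mod_cast hs
      generalize (Real.sin (γ + (k : ℝ) * Real.pi / d) : ℂ) = s at *
      push_cast
      linear_combination Complex.I_sq * s ^ 2 - hs'
    have h2 := norm_one_sub_neg_one_pow_mul_exp_tanAngle hd h0.le h1
    rw [← hγ, ← hpow k, he, ← mul_pow] at h2
    simp at h2
    linarith
  have hval : ∀ k : Fin d, cayleyPoint a (tanConfig a d D k) =
      -Complex.exp (2 * ((γ + (k : ℝ) * Real.pi / d : ℝ) : ℂ) * Complex.I) :=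
    fun k => cayleyPoint_mul_tan ha.ne' (hcos k)
  refine ⟨fun i j hij => ?_, fun k => ?_⟩
  · have h2 := (hval i).symm.trans ((congrArg (cayleyPoint a) hij).trans (hval j))
    rw [neg_inj, hexp, hexp] at h2
    exact Fin.ext (hζ.pow_inj i.2 j.2 (mul_left_cancel₀ (Complex.exp_ne_zero _) h2))
  · rw [hval, neg_pow, hpow]

theorem pairProd_eq_of_rootPoly_eq {d : ℕ} (hd : 2 ≤ d) {x y : Fin d → ℝ}
    (h : rootPoly x = rootPoly y) : pairProd x = pairProd y := by
  rw [← discr_rootPoly hd, h, discr_rootPoly hd]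

theorem extremal_iff_tanConfig {d : ℕ} (hd : 2 ≤ d) {a M D : ℝ} (ha : 0 < a)
    (hM : a ^ d * 2 ^ (d - 1) ≤ M)
    (hD : D = M ^ (2 * d - 2) * (d : ℝ) ^ d / (2 * a) ^ (d * (d - 1))) (x : Fin d → ℝ) :
    (distProd a x = M ∧ pairProd x = D) ↔
      (pointMultiset x = pointMultiset (tanConfig a d D) ∨
        pointMultiset x = pointMultiset (fun k => -tanConfig a d D k)) := by
  have hd0 : 0 < d := by lia
  have hM0 : 0 < M := lt_of_lt_of_le (by positivity) hM
  -- So `2p = (2a)^d / M` is the required value of `|1 - c|`, and `p ≤ 1` is exactly the threshold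
  -- on `M`.
  have hp : tanParam a d D = a ^ d * 2 ^ (d - 1) / M := by rw [hD]; exact tanParam_eq hd ha hM0
  have hp0 : 0 < tanParam a d D := by rw [hp]; positivity
  have hp1 : tanParam a d D ≤ 1 := by rw [hp, div_le_one hM0]; exact hM
  have h2p : 2 * tanParam a d D * M = (2 * a) ^ d := by
    rw [hp, mul_assoc, div_mul_cancel₀ _ hM0.ne', mul_pow]
    obtain ⟨e, rfl⟩ := Nat.exists_eq_succ_of_ne_zero hd0.ne'
    simp [pow_succ]
    ring
  obtain ⟨hTi, hTc⟩ := tanConfig_spec hd0 ha hp0 hp1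
  have hnorm := norm_one_sub_neg_one_pow_mul_exp_tanAngle hd0 hp0.le hp1
  set T := tanConfig a d D with hT
  set c := (-1) ^ d * Complex.exp (2 * tanAngle a d D * Complex.I) ^ d with hc
  have hc1 : ‖c‖ = 1 := by
    rw [← hTc ⟨0, hd0⟩, norm_pow, norm_cayleyPoint ha.ne', one_pow]
  have hSi : Function.Injective fun k => -T k := fun i j h => hTi (neg_injective h)
  have hSc : ∀ k, cayleyPoint a (-T k) ^ d = (starRingEnd ℂ) c := fun k => by
    rw [cayleyPoint_neg, ← map_pow, hTc]
  -- Used for the tangent points with `c`, and for their reflection with its conjugate.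
  have key : ∀ (y : Fin d → ℝ) (e : ℂ), Function.Injective y →
      (∀ k, cayleyPoint a (y k) ^ d = e) → ‖1 - e‖ = 2 * tanParam a d D →
      distProd a y = M ∧ pairProd y = D := by
    intro y e hy hye he
    have h1 := norm_one_sub_mul_distProd hd0 ha hy hye
    rw [he, ← h2p] at h1
    have h2 : distProd a y = M := mul_left_cancel₀ (by positivity) h1
    refine ⟨h2, ?_⟩
    rw [((pairProd_le hd0 ha y).2).2 ⟨hy, fun i j => by rw [hye, hye]⟩, h2, hD,
      Nat.mul_sub_one]
  have hconj : ‖1 - (starRingEnd ℂ) c‖ = 2 * tanParam a d D := by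
    rw [← hnorm, ← Complex.norm_conj]
    simp
  constructor
  · rintro ⟨h1, h2⟩
    rw [hD, ← h1, ← Nat.mul_sub_one] at h2
    obtain ⟨hx, hxc⟩ := ((pairProd_le hd0 ha x).2).1 h2
    have h3 := norm_one_sub_mul_distProd hd0 ha hx (fun k => hxc k ⟨0, hd0⟩)
    rw [h1, ← h2p, ← hnorm] at h3
    have h4 := mul_right_cancel₀ hM0.ne' h3
    have h5 : ‖cayleyPoint a (x ⟨0, hd0⟩) ^ d‖ = 1 := by
      rw [norm_pow, norm_cayleyPoint ha.ne', one_pow]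
    rw [pointMultiset_eq_iff, pointMultiset_eq_iff]
    rcases eq_or_eq_conj_of_norm_one_sub_eq h5 hc1 h4 with h6 | h6
    · exact Or.inl (rootPoly_eq_of_cayleyPoint_pow_eq hd0 ha hx hTi
        (fun k => (hxc k _).trans h6) hTc)
    · exact Or.inr (rootPoly_eq_of_cayleyPoint_pow_eq hd0 ha hx hSi
        (fun k => (hxc k _).trans h6) hSc)
  · rw [pointMultiset_eq_iff, pointMultiset_eq_iff]
    rintro (h | h)
    · rw [distProd_eq_of_rootPoly_eq a h, pairProd_eq_of_rootPoly_eq hd h]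
      exact key T c hTi hTc hnorm
    · rw [distProd_eq_of_rootPoly_eq a h, pairProd_eq_of_rootPoly_eq hd h]
      exact key _ _ hSi hSc hconj

/-! ### The polynomial `G` and its differential equation -/

theorem gCoeff_zero (d : ℕ) (lam : ℝ) : gCoeff d lam 0 = 1 := by simp [gCoeff]

theorem gFactor_pos {d : ℕ} {lam : ℝ} (h : 2 * (d : ℝ) - 2 ≤ lam) {j : ℕ} (hj : 1 ≤ j) :
    0 < lam - 2 * (d : ℝ) + 2 * (j : ℝ) + 1 := by
  have : (1 : ℝ) ≤ j := by exact_mod_cast hj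
  linarith

theorem gDenom_pos {d : ℕ} {lam : ℝ} (h : 2 * (d : ℝ) - 2 ≤ lam) (k : ℕ) :
    0 < ∏ j ∈ Finset.Icc 1 k, (lam - 2 * (d : ℝ) + 2 * (j : ℝ) + 1) :=
  Finset.prod_pos fun _ hj => gFactor_pos h (Finset.mem_Icc.1 hj).1

theorem doubleFactorial_two_mul_succ_sub_one (k : ℕ) :
    Nat.doubleFactorial (2 * (k + 1) - 1) = (2 * k + 1) * Nat.doubleFactorial (2 * k - 1) := by
  cases k with
  | zero => rfl
  | succ k => exact Nat.doubleFactorial_add_two (2 * k + 1)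

/-- The ratio of consecutive coefficients is the two-step recursion that `odeOp` imposes, up to the
factor `-a^2`. -/
theorem gCoeff_succ {d : ℕ} {lam : ℝ} (h : 2 * (d : ℝ) - 2 ≤ lam) {k : ℕ}
    (hk : 2 * (k + 1) ≤ d) :
    gCoeff d lam (k + 1) * (2 * (k + 1) * (lam - 2 * d + 2 * (k + 1) + 1)) =
      gCoeff d lam k * ((d - 2 * k) * (d - 2 * k - 1)) := by
  have hD := (gDenom_pos h k).ne'
  have hF := (gFactor_pos h (Nat.le_add_left 1 k)).ne'
  have hc : (d.choose (2 * (k + 1)) : ℝ) * ((2 * k + 2) * (2 * k + 1)) =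
      d.choose (2 * k) * ((d - 2 * k) * (d - 2 * k - 1)) := by
    have h1 := Nat.choose_succ_right_eq d (2 * k)
    have h2 := Nat.choose_succ_right_eq d (2 * k + 1)
    have h1' : (d.choose (2 * k + 1) : ℝ) * (2 * k + 1) = d.choose (2 * k) * (d - 2 * k) := by
      have := congrArg (Nat.cast : ℕ → ℝ) h1
      rw [Nat.cast_mul, Nat.cast_mul, Nat.cast_sub (by lia)] at this
      push_cast at this
      exact this
    have h2' : (d.choose (2 * (k + 1)) : ℝ) * (2 * k + 2) =
        d.choose (2 * k + 1) * (d - 2 * k - 1) := by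
      have := congrArg (Nat.cast : ℕ → ℝ) h2
      rw [Nat.cast_mul, Nat.cast_mul, Nat.cast_sub (by lia)] at this
      push_cast at this
      rw [show 2 * (k + 1) = 2 * k + 1 + 1 by ring]
      linear_combination this
    linear_combination (2 * k + 1 : ℝ) * h2' + (d - 2 * k - 1 : ℝ) * h1'
  unfold gCoeff
  rw [Finset.prod_Icc_succ_top (by lia), doubleFactorial_two_mul_succ_sub_one]
  push_cast at hF ⊢
  field_simp
  linear_combination hc

theorem gPoly_eq_sum (d : ℕ) (a lam : ℝ) : gPoly d a lam =
    ∑ k ∈ Finset.range (d / 2 + 1), C ((-1) ^ k * a ^ (2 * k) * gCoeff d lam k) * X ^ (d - 2 * k) := by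
  rw [Finset.range_eq_Ico, Finset.sum_eq_sum_Ico_succ_bot (by lia)]
  simp [gPoly, gCoeff_zero, ← Finset.Ico_add_one_right_eq_Icc]

theorem one_add_sum_gCoeff (d : ℕ) (lam : ℝ) :
    1 + ∑ k ∈ Finset.Icc 1 (d / 2), gCoeff d lam k =
      ∑ k ∈ Finset.range (d / 2 + 1), gCoeff d lam k := by
  rw [Finset.range_eq_Ico, Finset.sum_eq_sum_Ico_succ_bot (by lia)]
  simp [gCoeff_zero, ← Finset.Ico_add_one_right_eq_Icc]

/-- The differential operator whose polynomial solutions of degree `d` are multiples of `gPoly`. -/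
def odeOp (d : ℕ) (a lam : ℝ) (P : ℝ[X]) : ℝ[X] :=
  (X ^ 2 + C (a ^ 2)) * derivative (derivative P) - C lam * (X * derivative P) +
    C (lam * d - d * (d - 1)) * P

theorem coeff_odeOp (d : ℕ) (a lam : ℝ) (P : ℝ[X]) (n : ℕ) :
    (odeOp d a lam P).coeff n = (d - n) * (lam - (d + n - 1)) * P.coeff n +
      a ^ 2 * ((n + 2) * (n + 1)) * P.coeff (n + 2) := by
  unfold odeOp
  rw [add_mul]
  simp only [coeff_add, coeff_sub, coeff_C_mul]
  have h1 : (X * derivative P).coeff n = n * P.coeff n := by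
    cases n with
    | zero => simp
    | succ n => rw [coeff_X_mul, coeff_derivative]; push_cast; ring
  have h2 : (X ^ 2 * derivative (derivative P)).coeff n = n * (n - 1) * P.coeff n := by
    match n with
    | 0 => simp
    | 1 => simp [coeff_X_pow_mul']
    | n + 2 =>
      rw [coeff_X_pow_mul, coeff_derivative, coeff_derivative]
      push_cast
      ring
  rw [h1, h2, coeff_derivative, coeff_derivative]
  push_cast
  ring

/-- For `n < d` one has `d + n - 1 ≤ 2d - 2 < lam`, so the recursion determines the coefficient at
`n` from that at `n + 2`. The leading coefficient `1` yields the coefficients of `G`, and the zero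
at `d + 1` kills the other parity class. -/
theorem eq_gPoly_of_odeOp_eq_zero {d : ℕ} {a lam : ℝ} (h : 2 * (d : ℝ) - 2 < lam) {P : ℝ[X]}
    (hP : P.Monic) (hd : P.natDegree = d) (hode : odeOp d a lam P = 0) : P = gPoly d a lam := by
  have hrec : ∀ n : ℕ, (d - n) * (lam - (d + n - 1)) * P.coeff n +
      a ^ 2 * ((n + 2) * (n + 1)) * P.coeff (n + 2) = 0 := fun n => by
    rw [← coeff_odeOp, hode, coeff_zero]
  have hne : ∀ n : ℕ, n < d → ((d : ℝ) - n) * (lam - (d + n - 1)) ≠ 0 := fun n hn => by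
    have hn' : (n : ℝ) + 1 ≤ d := by exact_mod_cast hn
    exact mul_ne_zero (by linarith) (by linarith)
  have heven : ∀ k : ℕ, 2 * k ≤ d →
      P.coeff (d - 2 * k) = (-1) ^ k * a ^ (2 * k) * gCoeff d lam k := by
    intro k
    induction k with
    | zero =>
      intro _
      rw [gCoeff_zero]
      simpa [hd] using hP.coeff_natDegree
    | succ k ih =>
      intro hk
      have h1 := hrec (d - 2 * (k + 1))
      have h2 := hne (d - 2 * (k + 1)) (by lia)
      rw [show d - 2 * (k + 1) + 2 = d - 2 * k by lia, ih (by lia)] at h1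
      have hcast : ((d - 2 * (k + 1) : ℕ) : ℝ) = d - 2 * (k + 1) := by
        rw [Nat.cast_sub hk]; push_cast; ring
      rw [hcast] at h1 h2
      refine mul_left_cancel₀ h2 ?_
      have h3 := gCoeff_succ h.le hk
      rw [pow_succ, show 2 * (k + 1) = 2 * k + 2 by ring, pow_add]
      rw [show 2 * (k + 1) = 2 * k + 2 by ring] at h1
      linear_combination h1 + (-1) ^ k * a ^ (2 * k) * a ^ 2 * h3
  have hodd : ∀ k : ℕ, 2 * k + 1 ≤ d → P.coeff (d - (2 * k + 1)) = 0 := by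
    intro k
    induction k with
    | zero =>
      intro hk
      have h1 := hrec (d - 1)
      rw [show d - 1 + 2 = d + 1 by lia, coeff_eq_zero_of_natDegree_lt (n := d + 1) (by lia),
        mul_zero, add_zero] at h1
      exact (mul_eq_zero.1 h1).resolve_left (hne _ (by lia))
    | succ k ih =>
      intro hk
      have h1 := hrec (d - (2 * (k + 1) + 1))
      rw [show d - (2 * (k + 1) + 1) + 2 = d - (2 * k + 1) by lia, ih (by lia),
        mul_zero, add_zero] at h1
      exact (mul_eq_zero.1 h1).resolve_left (hne _ (by lia))
  ext n
  rw [gPoly_eq_sum, finsetSum_coeff]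
  simp only [coeff_C_mul, coeff_X_pow, mul_ite, mul_one, mul_zero]
  by_cases hn : n ≤ d
  · rcases Nat.even_or_odd' (d - n) with ⟨k, hk | hk⟩
    · rw [show n = d - 2 * k by lia, heven k (by lia), Finset.sum_eq_single k]
      · simp
      · intro j hj hjk
        rw [Finset.mem_range] at hj
        rw [if_neg (by lia)]
      · intro hk'
        rw [Finset.mem_range] at hk'
        lia
    · rw [show n = d - (2 * k + 1) by lia, hodd k (by lia), Finset.sum_eq_zero]
      intro j hj
      rw [Finset.mem_range] at hj
      rw [if_neg (by lia)]
  · rw [coeff_eq_zero_of_natDegree_lt (by lia), Finset.sum_eq_zero]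
    intro j hj
    rw [if_neg (by lia)]

/-- At `ai` the sign `(-1)^k` compensates the missing factor `i^{2k}`, so all terms have the same
phase `i^d` and add up without cancellation. -/
theorem norm_eval_map_gPoly {d : ℕ} {a lam : ℝ} (ha : 0 ≤ a) (h : 2 * (d : ℝ) - 2 ≤ lam) :
    ‖((gPoly d a lam).map Complex.ofRealHom).eval (a * Complex.I)‖ =
      a ^ d * (1 + ∑ k ∈ Finset.Icc 1 (d / 2), gCoeff d lam k) := by
  have hnn : 0 ≤ ∑ k ∈ Finset.range (d / 2 + 1), gCoeff d lam k :=
    Finset.sum_nonneg fun k _ => div_nonneg (by positivity) (gDenom_pos h k).le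
  have heval : ((gPoly d a lam).map Complex.ofRealHom).eval (a * Complex.I) =
      (a * Complex.I) ^ d * ((∑ k ∈ Finset.range (d / 2 + 1), gCoeff d lam k : ℝ) : ℂ) := by
    rw [gPoly_eq_sum, Polynomial.map_sum, eval_finsetSum, Complex.ofReal_sum, Finset.mul_sum]
    refine Finset.sum_congr rfl fun k hk => ?_
    rw [Finset.mem_range] at hk
    have h1 : (a * Complex.I) ^ d = (a * Complex.I) ^ (d - 2 * k) * ((-1) ^ k * a ^ (2 * k)) := by
      rw [← Complex.I_sq, ← pow_mul, mul_comm (Complex.I ^ _), ← mul_pow, ← pow_add]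
      congr 1
      lia
    rw [h1]
    simp
    ring
  rw [heval, one_add_sum_gCoeff, norm_mul, norm_pow, norm_mul, Complex.norm_I, mul_one,
    Complex.norm_real, Complex.norm_real, Real.norm_of_nonneg ha, Real.norm_of_nonneg hnn]

/-! ### Existence and uniqueness of the parameter -/

theorem sum_range_even {M : Type*} [AddCommMonoid M] (g : ℕ → M) (n : ℕ) :
    ∑ k ∈ Finset.range (n / 2 + 1), g (2 * k) =
      ∑ i ∈ Finset.range (n + 1), if Even i then g i else 0 := by
  induction n with
  | zero => simp
  | succ n ih =>
    rw [Finset.sum_range_succ _ (n + 1), ← ih]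
    rcases Nat.even_or_odd' n with ⟨m, rfl | rfl⟩
    · rw [if_neg (by simp), add_zero, show (2 * m + 1) / 2 = 2 * m / 2 by lia]
    · rw [if_pos (by simp [parity_simps]), show (2 * m + 1 + 1) / 2 = (2 * m + 1) / 2 + 1 by lia,
        Finset.sum_range_succ]
      congr 2
      lia

theorem sum_range_choose_even {d : ℕ} (hd : d ≠ 0) :
    ∑ k ∈ Finset.range (d / 2 + 1), (d.choose (2 * k) : ℝ) = 2 ^ (d - 1) := by
  rw [sum_range_even (fun i => (d.choose i : ℝ))]
  have h1 : ∑ i ∈ Finset.range (d + 1), (d.choose i : ℝ) = 2 ^ d := by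
    exact_mod_cast Nat.sum_range_choose d
  have h2 : ∑ i ∈ Finset.range (d + 1), ((-1) ^ i * d.choose i : ℝ) = 0 := by
    exact_mod_cast Int.alternating_sum_range_choose_of_ne hd
  have h3 : (2 : ℝ) * ∑ i ∈ Finset.range (d + 1), (if Even i then (d.choose i : ℝ) else 0) =
      2 ^ d := by
    refine Eq.trans ?_ ((congrArg₂ (· + ·) h1 h2).trans (add_zero _))
    rw [← Finset.sum_add_distrib, Finset.mul_sum]
    refine Finset.sum_congr rfl fun i _ => ?_
    split_ifs with hi
    · rw [hi.neg_one_pow]; ring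
    · rw [(Nat.not_even_iff_odd.1 hi).neg_one_pow]; ring
  obtain ⟨e, rfl⟩ := Nat.exists_eq_succ_of_ne_zero hd
  rw [pow_succ] at h3
  simp only [Nat.succ_eq_add_one, Nat.add_sub_cancel] at h3 ⊢
  linarith

/-- At this endpoint the denominator is `∏ (2j - 1) = (2k-1)!!`, so only the even binomial
coefficients remain. -/
theorem sum_gCoeff_two_mul_sub_two {d : ℕ} (hd : d ≠ 0) :
    ∑ k ∈ Finset.range (d / 2 + 1), gCoeff d (2 * d - 2) k = 2 ^ (d - 1) := by
  rw [← sum_range_choose_even hd]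
  refine Finset.sum_congr rfl fun k hk => ?_
  clear hk
  have h : ∏ j ∈ Finset.Icc 1 k, ((2 * d - 2 : ℝ) - 2 * (d : ℝ) + 2 * (j : ℝ) + 1) =
      ((Nat.doubleFactorial (2 * k - 1) : ℕ) : ℝ) := by
    induction k with
    | zero => simp
    | succ k ih =>
      rw [Finset.prod_Icc_succ_top (by lia), ih, doubleFactorial_two_mul_succ_sub_one]
      push_cast
      ring
  have hne : ((Nat.doubleFactorial (2 * k - 1) : ℕ) : ℝ) ≠ 0 := by
    exact_mod_cast (Nat.doubleFactorial_pos _).ne'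
  rw [gCoeff, h, mul_div_cancel_right₀ _ hne]

theorem gCoeff_lt_gCoeff {d : ℕ} {lam mu : ℝ} (h : 2 * (d : ℝ) - 2 ≤ lam) (hlt : lam < mu)
    {k : ℕ} (hk : 1 ≤ k) (hkd : 2 * k ≤ d) : gCoeff d mu k < gCoeff d lam k := by
  unfold gCoeff
  have h1 : (0 : ℝ) < d.choose (2 * k) := by exact_mod_cast Nat.choose_pos hkd
  have h2 : (0 : ℝ) < ((Nat.doubleFactorial (2 * k - 1) : ℕ) : ℝ) := by
    exact_mod_cast Nat.doubleFactorial_pos _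
  refine div_lt_div_of_pos_left (mul_pos h1 h2) (gDenom_pos h k) ?_
  refine Finset.prod_lt_prod (fun j hj => gFactor_pos h (Finset.mem_Icc.1 hj).1)
    (fun j _ => by linarith) ⟨1, Finset.mem_Icc.2 ⟨le_rfl, hk⟩, by linarith⟩

theorem tendsto_gCoeff (d : ℕ) {k : ℕ} (hk : 1 ≤ k) :
    Filter.Tendsto (fun lam => gCoeff d lam k) Filter.atTop (nhds 0) := by
  have h : Filter.Tendsto
      (fun lam : ℝ => ∏ j ∈ Finset.Icc 1 k, (lam - 2 * (d : ℝ) + 2 * (j : ℝ) + 1)⁻¹)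
      Filter.atTop (nhds (∏ j ∈ Finset.Icc 1 k, 0)) := by
    refine tendsto_finsetProd _ fun j _ => Filter.Tendsto.inv_tendsto_atTop ?_
    have := Filter.tendsto_atTop_add_const_right Filter.atTop (-2 * (d : ℝ) + 2 * (j : ℝ) + 1)
      (Filter.tendsto_id (α := ℝ))
    refine this.congr fun lam => ?_
    simp only [id]
    ring
  rw [Finset.prod_const, zero_pow (by simp; lia)] at h
  have h2 := h.const_mul ((d.choose (2 * k) : ℝ) * ((Nat.doubleFactorial (2 * k - 1) : ℕ) : ℝ))
  rw [mul_zero] at h2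
  refine h2.congr fun lam => ?_
  rw [Finset.prod_inv_distrib, gCoeff, div_eq_mul_inv]

/-- Intermediate values for a strictly decreasing function with value `2^{d-1}` at `2d - 2` and
limit `1`; strictness needs the term `k = 1`, present because `d ≥ 2`. -/
theorem existsUnique_sum_gCoeff_eq {d : ℕ} (hd : 2 ≤ d) {m : ℝ} (h1 : 1 < m)
    (h2 : m < 2 ^ (d - 1)) :
    ∃! lam : ℝ, 2 * (d : ℝ) - 2 < lam ∧
      1 + ∑ k ∈ Finset.Icc 1 (d / 2), gCoeff d lam k = m := by
  set f : ℝ → ℝ := fun lam => 1 + ∑ k ∈ Finset.Icc 1 (d / 2), gCoeff d lam k with hf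
  have hanti : ∀ lam mu, 2 * (d : ℝ) - 2 ≤ lam → lam < mu → f mu < f lam := by
    intro lam mu hl hlt
    refine add_lt_add_right (Finset.sum_lt_sum_of_nonempty ⟨1, ?_⟩ fun k hk => ?_) 1
    · rw [Finset.mem_Icc]; lia
    · rw [Finset.mem_Icc] at hk
      exact gCoeff_lt_gCoeff hl hlt hk.1 (by lia)
  have hf0 : f (2 * d - 2) = 2 ^ (d - 1) := by
    simp only [hf]
    rw [one_add_sum_gCoeff, sum_gCoeff_two_mul_sub_two (by lia)]
  have hlim : Filter.Tendsto f Filter.atTop (nhds 1) := by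
    have := (tendsto_finsetSum (Finset.Icc 1 (d / 2)) fun k hk =>
      tendsto_gCoeff d (Finset.mem_Icc.1 hk).1).const_add 1
    simpa using this
  obtain ⟨L, hL1, hL2⟩ := ((hlim.eventually (gt_mem_nhds h1)).and
    (Filter.eventually_gt_atTop (2 * (d : ℝ) - 2))).exists
  have hcont : ContinuousOn f (Set.Icc (2 * (d : ℝ) - 2) L) := by
    refine continuousOn_const.add (continuousOn_finsetSum _ fun k _ => ?_)
    refine ContinuousOn.div continuousOn_const (by fun_prop) fun lam hlam => ?_
    exact (gDenom_pos hlam.1 k).ne'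
  obtain ⟨lam, hlam, hlam'⟩ := intermediate_value_Ioo' hL2.le hcont ⟨hL1, by rwa [hf0]⟩
  refine ⟨lam, ⟨hlam.1, hlam'⟩, fun mu ⟨hmu, hmu'⟩ => ?_⟩
  change f mu = m at hmu'
  rcases lt_trichotomy mu lam with hlt | heq | hgt
  · have := hanti mu lam hmu.le hlt
    linarith
  · exact heq
  · have := hanti lam mu hlam.1.le hgt
    linarith

/-! ### Maximising the weighted discriminant -/

theorem continuous_pairProd (d : ℕ) : Continuous (pairProd : (Fin d → ℝ) → ℝ) := by
  unfold pairProd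
  fun_prop

theorem continuous_distProd (d : ℕ) (a : ℝ) : Continuous (distProd a : (Fin d → ℝ) → ℝ) := by
  unfold distProd
  fun_prop

theorem tendsto_distProd_cocompact {d : ℕ} (hd : 0 < d) {a : ℝ} (ha : 0 < a) :
    Filter.Tendsto (distProd a : (Fin d → ℝ) → ℝ) (Filter.cocompact _) Filter.atTop := by
  have hge : ∀ t : ℝ, a ≤ ‖(a * Complex.I - t : ℂ)‖ := fun t => by
    refine le_of_sq_le_sq ?_ (norm_nonneg _)
    rw [norm_mul_I_sub_sq]
    nlinarith [sq_nonneg t]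
  have habs : ∀ t : ℝ, ‖t‖ ≤ ‖(a * Complex.I - t : ℂ)‖ := fun t => by
    refine le_of_sq_le_sq ?_ (norm_nonneg _)
    rw [norm_mul_I_sub_sq, Real.norm_eq_abs, sq_abs]
    nlinarith [sq_nonneg a]
  have hbound : ∀ x : Fin d → ℝ, a ^ (d - 1) * ‖x‖ ≤ distProd a x := by
    intro x
    have : Nonempty (Fin d) := ⟨⟨0, hd⟩⟩
    obtain ⟨i, hi⟩ : ∃ i, ‖x‖ = ‖x i‖ := by
      obtain ⟨i, -, hi⟩ := Finset.exists_max_image Finset.univ (fun i => ‖x i‖) Finset.univ_nonempty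
      exact ⟨i, le_antisymm ((pi_norm_le_iff_of_nonneg (norm_nonneg _)).2
        fun j => hi j (Finset.mem_univ j)) (norm_le_pi_norm x i)⟩
    unfold distProd
    rw [hi, ← Finset.prod_erase_mul _ _ (Finset.mem_univ i)]
    refine mul_le_mul ?_ (habs _) (norm_nonneg _) (Finset.prod_nonneg fun _ _ => norm_nonneg _)
    have := Finset.prod_le_prod (s := Finset.univ.erase i) (f := fun _ => a)
      (g := fun k => ‖(a * Complex.I - x k : ℂ)‖) (fun _ _ => ha.le) fun k _ => hge (x k)
    simpa using this
  exact Filter.tendsto_atTop_mono hbound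
    (tendsto_norm_cocompact_atTop.const_mul_atTop (pow_pos ha _))

/-- The discriminant weighted by the distances of the points to `a i`. -/
def weightedDisc {d : ℕ} (a lam : ℝ) (x : Fin d → ℝ) : ℝ := pairProd x * distProd a x ^ (-lam)

/-- By `pairProd_le` the weighted discriminant is at most a constant times `distProd` to the power
`-(lam - (2d - 2))`, which tends to `0` at infinity. -/
theorem exists_max_weightedDisc {d : ℕ} (hd : 0 < d) {a lam : ℝ} (ha : 0 < a)
    (hlam : 2 * (d : ℝ) - 2 < lam) :
    ∃ x : Fin d → ℝ, pairProd x ≠ 0 ∧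
      ∀ y : Fin d → ℝ, weightedDisc a lam y ≤ weightedDisc a lam x := by
  have hN := fun x : Fin d → ℝ => distProd_pos ha x
  have hcont : Continuous (weightedDisc a lam : (Fin d → ℝ) → ℝ) :=
    (continuous_pairProd d).mul
      ((continuous_distProd d a).rpow_const fun x => Or.inl (hN x).ne')
  set K : ℝ := (d : ℝ) ^ d / (2 * a) ^ (d * (d - 1)) with hK
  have hle : ∀ x : Fin d → ℝ, weightedDisc a lam x ≤
      K * distProd a x ^ (-(lam - (2 * (d : ℝ) - 2))) := by
    intro x
    have h1 := (pairProd_le hd ha x).1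
    have h2 : distProd a x ^ (-(lam - (2 * (d : ℝ) - 2))) =
        distProd a x ^ (2 * (d - 1)) * distProd a x ^ (-lam) := by
      rw [← Real.rpow_natCast, ← Real.rpow_add (hN x)]
      congr 1
      rw [Nat.cast_mul, Nat.cast_sub (by lia)]
      push_cast
      ring
    rw [h2, weightedDisc, ← mul_assoc]
    refine mul_le_mul_of_nonneg_right (h1.trans_eq ?_) (Real.rpow_nonneg (hN x).le _)
    rw [hK]
    ring
  have hlim : Filter.Tendsto (weightedDisc a lam : (Fin d → ℝ) → ℝ)
      (Filter.cocompact _) (nhds 0) := by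
    have h := ((tendsto_rpow_neg_atTop (sub_pos.2 hlam)).comp
      (tendsto_distProd_cocompact hd ha)).const_mul K
    rw [mul_zero] at h
    exact squeeze_zero (fun x => mul_nonneg (pairProd_nonneg x) (Real.rpow_nonneg (hN x).le _))
      hle h
  -- Any configuration of distinct points would do: its positive value shows that the supremum is
  -- not approached at infinity only.
  set x₀ : Fin d → ℝ := fun k => (k : ℕ) with hx₀
  have hx₀pos : 0 < weightedDisc a lam x₀ := by
    refine mul_pos (lt_of_le_of_ne (pairProd_nonneg _) (Ne.symm ?_)) (Real.rpow_pos_of_pos (hN _) _)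
    rw [pairProd_ne_zero_iff]
    exact fun i j hij => Fin.ext (Nat.cast_injective (R := ℝ) hij)
  obtain ⟨x, hx⟩ := hcont.exists_forall_ge' x₀
    ((hlim.eventually (gt_mem_nhds hx₀pos)).mono fun _ h => h.le)
  refine ⟨x, fun h0 => ?_, hx⟩
  have := hx x₀
  rw [weightedDisc, weightedDisc, h0, zero_mul] at this
  exact absurd this (not_le.2 hx₀pos)

theorem pairProd_update {d : ℕ} (x : Fin d → ℝ) (i : Fin d) (t : ℝ) :
    pairProd (Function.update x i t) =
      (∏ k ∈ Finset.univ.erase i, (t - x k)) ^ 2 *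
        ∏ j ∈ Finset.univ.erase i, ∏ k ∈ (Finset.univ.erase j).erase i, |x j - x k| := by
  unfold pairProd
  rw [← Finset.mul_prod_erase _ _ (Finset.mem_univ i), ← sq_abs, Finset.abs_prod, sq, mul_assoc,
    ← Finset.prod_mul_distrib, ← Finset.prod_mul_distrib, ← Finset.prod_mul_distrib]
  refine Finset.prod_congr rfl fun j hj => ?_
  have hji := Finset.ne_of_mem_erase hj
  rw [← Finset.mul_prod_erase (Finset.univ.erase j) _
      (Finset.mem_erase.2 ⟨hji.symm, Finset.mem_univ i⟩),
    Function.update_self, Function.update_of_ne hji, abs_sub_comm (x j) t]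
  congr 2
  refine Finset.prod_congr rfl fun k hk => ?_
  rw [Function.update_of_ne (Finset.ne_of_mem_erase hk)]

theorem distProd_update {d : ℕ} (a : ℝ) (x : Fin d → ℝ) (i : Fin d) (t : ℝ) :
    distProd a (Function.update x i t) =
      ‖(a * Complex.I - t : ℂ)‖ * ∏ k ∈ Finset.univ.erase i, ‖(a * Complex.I - x k : ℂ)‖ := by
  unfold distProd
  rw [← Finset.mul_prod_erase _ _ (Finset.mem_univ i), Function.update_self]
  congr 1
  refine Finset.prod_congr rfl fun k hk => ?_
  rw [Function.update_of_ne (Finset.ne_of_mem_erase hk)]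

theorem norm_mul_I_sub_rpow (a t s : ℝ) :
    ‖(a * Complex.I - t : ℂ)‖ ^ s = (t ^ 2 + a ^ 2) ^ (s / 2) := by
  rw [← norm_mul_I_sub_sq, ← Real.rpow_natCast, ← Real.rpow_mul (norm_nonneg _)]
  congr 1
  push_cast
  ring

/-- Moving only the `i`-th point leaves a constant times `q(t)^2 (t^2 + a^2)^{-lam/2}`, where `P =
(X - x_i) q`. Its derivative vanishes at `x_i`, and `P'(x_i) = q(x_i)`, `P''(x_i) = 2 q'(x_i)`. -/
theorem critical_of_max_weightedDisc {d : ℕ} {a lam : ℝ} (ha : 0 < a) {x : Fin d → ℝ}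
    (hx : pairProd x ≠ 0)
    (hmax : ∀ y : Fin d → ℝ, weightedDisc a lam y ≤ weightedDisc a lam x) (i : Fin d) :
    (x i ^ 2 + a ^ 2) * (derivative (derivative (rootPoly x))).eval (x i) =
      lam * (x i * (derivative (rootPoly x)).eval (x i)) := by
  set q : ℝ[X] := ∏ k ∈ Finset.univ.erase i, (X - C (x k)) with hq
  have hqe : ∀ t, q.eval t = ∏ k ∈ Finset.univ.erase i, (t - x k) := fun t => by
    simp [hq, eval_prod]
  set R := ∏ j ∈ Finset.univ.erase i, ∏ k ∈ (Finset.univ.erase j).erase i, |x j - x k| with hR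
  set S := ∏ k ∈ Finset.univ.erase i, ‖(a * Complex.I - x k : ℂ)‖ with hS
  have hSpos : 0 < S := Finset.prod_pos fun k _ => norm_mul_I_sub_pos ha (x k)
  have hpair : pairProd x = q.eval (x i) ^ 2 * R := by
    have := pairProd_update x i (x i)
    rwa [Function.update_eq_self, ← hqe] at this
  have hq0 : q.eval (x i) ≠ 0 := fun h => hx (by rw [hpair, h]; ring)
  have hR0 : 0 < R := by
    refine lt_of_le_of_ne (Finset.prod_nonneg fun _ _ => Finset.prod_nonneg fun _ _ =>
      abs_nonneg _) fun h => hx (by rw [hpair, ← h]; ring)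
  have hpos : ∀ t : ℝ, 0 < t ^ 2 + a ^ 2 := fun t => by positivity
  have hF : ∀ t, weightedDisc a lam (Function.update x i t) =
      (q.eval t ^ 2 * (t ^ 2 + a ^ 2) ^ (-lam / 2)) * (R * S ^ (-lam)) := fun t => by
    rw [weightedDisc, pairProd_update, distProd_update, ← hqe, ← hR, ← hS,
      Real.mul_rpow (norm_nonneg _) hSpos.le, norm_mul_I_sub_rpow]
    ring
  have hloc : IsLocalMax (fun t => q.eval t ^ 2 * (t ^ 2 + a ^ 2) ^ (-lam / 2)) (x i) := by
    refine Filter.Eventually.of_forall fun t => ?_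
    have h1 := hmax (Function.update x i t)
    rw [hF] at h1
    have h2 := hF (x i)
    rw [Function.update_eq_self] at h2
    rw [h2] at h1
    exact le_of_mul_le_mul_right h1 (mul_pos hR0 (Real.rpow_pos_of_pos hSpos _))
  have hderiv : HasDerivAt (fun t => q.eval t ^ 2 * (t ^ 2 + a ^ 2) ^ (-lam / 2))
      ((2 * q.eval (x i) * (derivative q).eval (x i)) * (x i ^ 2 + a ^ 2) ^ (-lam / 2) +
        q.eval (x i) ^ 2 * (2 * x i * (-lam / 2) * (x i ^ 2 + a ^ 2) ^ (-lam / 2 - 1))) (x i) := by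
    have h1 : HasDerivAt (fun t => q.eval t ^ 2)
        (2 * q.eval (x i) * (derivative q).eval (x i)) (x i) := by
      simpa using (q.hasDerivAt (x i)).fun_pow 2
    have h2 : HasDerivAt (fun t : ℝ => t ^ 2 + a ^ 2) (2 * x i) (x i) := by
      simpa using ((hasDerivAt_id' (x i)).fun_pow 2).add_const (a ^ 2)
    exact h1.mul (h2.rpow_const (Or.inl (hpos _).ne'))
  have h0 := hloc.hasDerivAt_eq_zero hderiv
  have hE : (0 : ℝ) < (x i ^ 2 + a ^ 2) ^ (-lam / 2 - 1) := Real.rpow_pos_of_pos (hpos _) _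
  have hE2 : (x i ^ 2 + a ^ 2) ^ (-lam / 2) =
      (x i ^ 2 + a ^ 2) ^ (-lam / 2 - 1) * (x i ^ 2 + a ^ 2) := by
    rw [Real.rpow_sub_one (hpos _).ne', div_mul_cancel₀ _ (hpos _).ne']
  rw [hE2] at h0
  have hP1 : (derivative (rootPoly x)).eval (x i) = q.eval (x i) := by
    rw [rootPoly_eq_mul x i, ← hq, derivative_mul]
    simp
  have hP2 : (derivative (derivative (rootPoly x))).eval (x i) =
      2 * (derivative q).eval (x i) := by
    rw [rootPoly_eq_mul x i, ← hq, derivative_mul, derivative_add, derivative_mul]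
    simp
    ring
  rw [hP1, hP2]
  refine mul_left_cancel₀ (mul_ne_zero hq0 hE.ne') ?_
  linear_combination h0

/-- `odeOp` cancels the coefficient at `X^d`, so its value at `P` has degree below `d`; by
criticality it vanishes at `d` distinct points, hence identically. -/
theorem rootPoly_eq_gPoly_of_max {d : ℕ} {a lam : ℝ} (ha : 0 < a)
    (hlam : 2 * (d : ℝ) - 2 < lam) {x : Fin d → ℝ} (hx : pairProd x ≠ 0)
    (hmax : ∀ y : Fin d → ℝ, weightedDisc a lam y ≤ weightedDisc a lam x) :
    rootPoly x = gPoly d a lam := by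
  refine eq_gPoly_of_odeOp_eq_zero hlam (rootPoly_monic x) (rootPoly_natDegree x) ?_
  refine eq_zero_of_degree_lt_of_eval_index_eq_zero (v := x) Finset.univ
    ((pairProd_ne_zero_iff x).1 hx).injOn ?_ fun i _ => ?_
  · rw [Finset.card_univ, Fintype.card_fin, degree_lt_iff_coeff_zero]
    intro n hn
    rw [coeff_odeOp, coeff_eq_zero_of_natDegree_lt (n := n + 2) (by rw [rootPoly_natDegree]; lia)]
    rcases hn.eq_or_lt with rfl | hn
    · simp
    · rw [coeff_eq_zero_of_natDegree_lt (by rw [rootPoly_natDegree]; exact hn)]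
      simp
  · have h := critical_of_max_weightedDisc ha hx hmax i
    have h0 : (rootPoly x).eval (x i) = 0 := by
      rw [rootPoly_eq_mul x i]; simp
    simp [odeOp, h0]
    linarith

/-- `gPoly` is the polynomial of the maximizing configurations of the weighted discriminant. -/
theorem exists_rootPoly_eq_gPoly {d : ℕ} (hd : 0 < d) {a lam : ℝ} (ha : 0 < a)
    (hlam : 2 * (d : ℝ) - 2 < lam) :
    ∃ x : Fin d → ℝ, rootPoly x = gPoly d a lam ∧ pairProd x ≠ 0 ∧
      distProd a x = a ^ d * (1 + ∑ k ∈ Finset.Icc 1 (d / 2), gCoeff d lam k) ∧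
      ∀ y : Fin d → ℝ, distProd a y = distProd a x →
        pairProd y ≤ pairProd x ∧ (pairProd y = pairProd x → rootPoly y = gPoly d a lam) := by
  obtain ⟨x, hx, hmax⟩ := exists_max_weightedDisc hd ha hlam
  have hG := rootPoly_eq_gPoly_of_max ha hlam hx hmax
  refine ⟨x, hG, hx, ?_, fun y hy => ⟨?_, fun he => ?_⟩⟩
  · rw [← norm_eval_map_rootPoly, hG, norm_eval_map_gPoly ha.le hlam.le]
  · have h := hmax y
    rw [weightedDisc, weightedDisc, hy] at h
    exact le_of_mul_le_mul_right h (Real.rpow_pos_of_pos (distProd_pos ha x) _)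
  -- Equal discriminant and equal distance product make `y` a global maximiser too, so it has the
  -- same polynomial.
  · refine rootPoly_eq_gPoly_of_max ha hlam (he ▸ hx) fun z => ?_
    rw [weightedDisc.eq_def a lam y, hy, he]
    exact hmax z

/-! ### Translation of the constants and conclusion -/

theorem log_extremal_discr {d : ℕ} (hd : 2 ≤ d) {a : ℝ} (v : ℝ) (ha : 0 < a) :
    -Real.log (Real.exp (-v * d) ^ (2 * d - 2) * (d : ℝ) ^ d / (2 * a) ^ (d * (d - 1))) /
      ((d : ℝ) * ((d : ℝ) - 1)) = 2 * v + Real.log (2 * a) - Real.log d / ((d : ℝ) - 1) := by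
  have hd' : (2 : ℝ) ≤ d := by exact_mod_cast hd
  have hd0 : (0 : ℝ) < d := by linarith
  have hne' : ((d : ℝ) - 1) ≠ 0 := by linarith
  have hc : ((2 * d - 2 : ℕ) : ℝ) = 2 * d - 2 := by
    rw [Nat.cast_sub (by lia)]; push_cast; ring
  have hc1 : ((d - 1 : ℕ) : ℝ) = d - 1 := by
    rw [Nat.cast_sub (by lia)]; push_cast; ring
  rw [Real.log_div (by positivity) (by positivity), Real.log_mul (by positivity) (by positivity),
    Real.log_pow, Real.log_pow, Real.log_pow, Real.log_exp, hc, Nat.cast_mul, hc1]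
  field_simp
  ring

theorem log_pow_mul_two_pow {d : ℕ} (hd : 0 < d) {a : ℝ} (ha : 0 < a) :
    Real.log (a ^ d * 2 ^ (d - 1)) = -((1 / (d : ℝ) - 1) * Real.log 2 - Real.log a) * d := by
  have hd0 : (d : ℝ) ≠ 0 := by positivity
  rw [Real.log_mul (by positivity) (by positivity), Real.log_pow, Real.log_pow,
    Nat.cast_sub hd, Nat.cast_one]
  field_simp
  ring

theorem theorem9 (d : ℕ) (hd : 2 ≤ d) (a v : ℝ) (ha : 0 < a) (hv : v < -Real.log a) :
    -- the general lower bound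
    (∀ x : Fin d → ℝ, logPotential (countingMeasure x) (a * Complex.I) = v →
      ((2 * v + Real.log (2 * a) - Real.log d / ((d : ℝ) - 1) : ℝ) : EReal) ≤ discreteEnergy x) ∧
    -- sharpness for small `v`, where `D` is the discriminant that corresponds to equality
    (v ≤ (1 / (d : ℝ) - 1) * Real.log 2 - Real.log a →
      ∀ D : ℝ, D = Real.exp (-v * d) ^ (2 * d - 2) * (d : ℝ) ^ d / (2 * a) ^ (d * (d - 1)) →
      ∀ x : Fin d → ℝ,
        (logPotential (countingMeasure x) (a * Complex.I) = v ∧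
          discreteEnergy x =
            ((2 * v + Real.log (2 * a) - Real.log d / ((d : ℝ) - 1) : ℝ) : EReal)) ↔
        (pointMultiset x = pointMultiset (tanConfig a d D) ∨
          pointMultiset x = pointMultiset (fun k => -tanConfig a d D k))) ∧
    -- the remaining range of `v`
    ((1 / (d : ℝ) - 1) * Real.log 2 - Real.log a < v →
      (∃! lam : ℝ, IsEquilibriumParam d a v lam) ∧
      ∀ lam : ℝ, IsEquilibriumParam d a v lam →
        (gPoly d a lam).Splits ∧ 0 < (gPoly d a lam).discr ∧
        (∀ x : Fin d → ℝ, logPotential (countingMeasure x) (a * Complex.I) = v →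
          ((-Real.log (gPoly d a lam).discr / ((d : ℝ) * ((d : ℝ) - 1)) : ℝ) : EReal)
            ≤ discreteEnergy x) ∧
        ∀ x : Fin d → ℝ,
          (logPotential (countingMeasure x) (a * Complex.I) = v ∧
            discreteEnergy x =
              ((-Real.log (gPoly d a lam).discr / ((d : ℝ) * ((d : ℝ) - 1)) : ℝ) : EReal)) ↔
          pointMultiset x = (gPoly d a lam).roots) := by
  have hd0 : 0 < d := by lia
  have hdR : (0 : ℝ) < d := by exact_mod_cast hd0
  set M := Real.exp (-v * d) with hM
  have hM0 : 0 < M := Real.exp_pos _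
  have hB0 : 0 < M ^ (2 * d - 2) * (d : ℝ) ^ d / (2 * a) ^ (d * (d - 1)) := by positivity
  have hthr : Real.exp (Real.log (a ^ d * 2 ^ (d - 1))) = a ^ d * 2 ^ (d - 1) :=
    Real.exp_log (by positivity)
  rw [log_pow_mul_two_pow hd0 ha] at hthr
  simp only [logPotential_eq_iff hd0 ha, ← log_extremal_discr hd v ha, ← hM]
  refine ⟨fun x hx => ?_, fun hsmall D hD x => ?_, fun hlarge => ⟨?_, fun lam hlam => ?_⟩⟩
  · rw [le_discreteEnergy_iff hd x hB0, ← hx, ← Nat.mul_sub_one]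
    exact (pairProd_le hd0 ha x).1
  · rw [discreteEnergy_eq_iff hd x hB0, ← hD]
    refine extremal_iff_tanConfig hd ha ?_ hD x
    -- After exponentiation the threshold on `v` reads `a^d 2^{d-1} ≤ M`.
    rw [← hthr, hM, Real.exp_le_exp]
    nlinarith
  · refine existsUnique_sum_gCoeff_eq hd ?_ ?_
    · rw [one_lt_div (by positivity), ← hM, ← Real.exp_log (pow_pos ha d), hM, Real.exp_lt_exp,
        Real.log_pow]
      nlinarith
    · rw [div_lt_iff₀ (by positivity), mul_comm (2 ^ (d - 1)), ← hthr, Real.exp_lt_exp]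
      nlinarith
  · obtain ⟨x₀, hG, hx₀, hN, hmax⟩ := exists_rootPoly_eq_gPoly hd0 ha hlam.1
    have hdisc : (gPoly d a lam).discr = pairProd x₀ := by rw [← hG, discr_rootPoly hd]
    have hpos : 0 < pairProd x₀ := lt_of_le_of_ne (pairProd_nonneg x₀) hx₀.symm
    -- The defining equation of `lam` says precisely that the roots of `G` have the prescribed
    -- potential.
    rw [hlam.2, mul_div_cancel₀ _ (pow_pos ha d).ne', ← hM] at hN
    rw [hdisc]
    refine ⟨hG ▸ rootPoly_splits x₀, hpos, fun x hx => ?_, fun x => ?_⟩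
    · rw [le_discreteEnergy_iff hd x hpos]
      exact (hmax x (hx.trans hN.symm)).1
    · rw [discreteEnergy_eq_iff hd x hpos, ← hG, rootPoly_roots, pointMultiset_eq_iff]
      constructor
      · rintro ⟨hx, he⟩
        rw [hG]
        exact (hmax x (hx.trans hN.symm)).2 he
      · intro h
        exact ⟨(distProd_eq_of_rootPoly_eq a h).trans hN, pairProd_eq_of_rootPoly_eq hd h⟩

end
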